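/- Let $k$ be a field of characteristic zero and put $F(s,t,u)=s^2+t^2+u^2-stu-4$. Let $M_0\subset\mathbb{A}^3_k$ be the Cayley cubic $F(s,t,u)=0$ and let $V=\mathbb{A}^3_k\setminus M_0$. Let $f\colon \mathrm{SL}(2)\times_k\mathrm{SL}(2)\to\mathbb{A}^3_k$ be the morphism $f(A,B)=(\mathrm{tr}(A),\mathrm{tr}(B),\mathrm{tr}(AB))$, and let $\mathcal{T}=f^{-1}(V)$, on which $\mathrm{PGL}(2)$ acts by simultaneous conjugation; $\mathcal{T}\to V$ is a $\mathrm{PGL}(2)$-torsor for the étale topology. Let $X=(\mathcal{T}\times_k\mathbb{P}^1_k)/\mathrm{PGL}(2)$ be the quotient, for the étale topology, by the diagonal action of $\mathrm{PGL}(2)$ (by simultaneous conjugation on $\mathcal{T}$ and by the standard action on $\mathbb{P}^1_k$), with the morphism $X\to V$ induced by $f$; this is a smooth conic bundle over $V$. Let $K=k(s,t,u)$ be the function field of $\mathbb{A}^3_k$ and let $X_K=X\times_V\mathrm{Spec}(K)$ be the generic fibre of $X\to V$. Then $X_K$ is a form of $\mathbb{P}^1$ over $K$ (a smooth projective conic),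 and its class, that is, the image of its class in $\mathrm{H}^1(K,\mathrm{PGL}(2))$ under the connecting map $\mathrm{H}^1(K,\mathrm{PGL}(2))\to\mathrm{H}^2(K,\mu_2)$ attached to $1\to\mu_2\to\mathrm{SL}(2)\to\mathrm{PGL}(2)\to1$, is $$[X_K]=(t^2-4,\,F(s,t,u))\in\mathrm{H}^2(K,\mu_2),$$ where $(a,b)$ denotes the quaternion symbol, i.e. the cup product of the classes of $a,b\in K^\times$ in $\mathrm{H}^1(K,\mu_2)=K^\times/K^{\times2}$, under the identification $\mu_2\otimes\mu_2=\mu_2$. -/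

import Mathlib

universe u w

namespace TraceConic

open CategoryTheory

noncomputable section

/-! ### Functors on `k`-algebras and quotients for the étale topology

Schemes over `k` and étale sheaves over `k` are given by their functors of points on commutative
`k`-algebras (equivalently, on affine `k`-schemes). -/

/-- The category of commutative algebras over `k`. -/
abbrev AlgOver (k : Type u) [CommRing k] : Type (u + 1) := Under (CommRingCat.of k)

/-- `Spec S ⟶ Spec R` is an étale covering: `R ⟶ S` is étale and faithfully flat.
(Finite coverings `{Spec Sᵢ ⟶ Spec R}` are included through `S = ∏ Sᵢ`.) -/
def IsEtaleCover {k : Type u} [CommRing k] {R S : AlgOver k} (f : R ⟶ S) : Prop :=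
  f.right.hom.Etale ∧ f.right.hom.FaithfullyFlat

theorem IsEtaleCover.baseChange {k : Type u} [CommRing k] {R S R' : AlgOver k} {f : R ⟶ S}
    (hf : IsEtaleCover f) (g : R ⟶ R') :
    ∃ (S' : AlgOver k) (f' : R' ⟶ S') (g' : S ⟶ S'), IsEtaleCover f' ∧ g ≫ f' = f ≫ g' := by
  let _ := f.right.hom.toAlgebra
  let _ := g.right.hom.toAlgebra
  have _ : Algebra.Etale R.right S.right := hf.1
  have _ : Module.FaithfullyFlat R.right S.right := hf.2
  have key : g.right ≫ CommRingCat.ofHom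
        (algebraMap R'.right (TensorProduct R.right R'.right S.right)) =
      f.right ≫ CommRingCat.ofHom (Algebra.TensorProduct.includeRight
        (R := R.right) (A := R'.right) (B := S.right)).toRingHom := by
    ext x
    exact (((Algebra.TensorProduct.includeRight
      (R := R.right) (A := R'.right) (B := S.right)).commutes x).symm)
  refine ⟨Under.mk (R'.hom ≫ CommRingCat.ofHom
      (algebraMap R'.right (TensorProduct R.right R'.right S.right))),
    Under.homMk (CommRingCat.ofHom (algebraMap _ _)) rfl,
    Under.homMk (CommRingCat.ofHom (Algebra.TensorProduct.includeRight
      (R := R.right) (A := R'.right) (B := S.right)).toRingHom) ?_, ⟨?_, ?_⟩, ?_⟩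
  · have h1 := Under.w f
    have h2 := Under.w g
    change S.hom ≫ _ = R'.hom ≫ _
    rw [← h1, ← h2, Category.assoc, Category.assoc, key]
  · exact (RingHom.etale_algebraMap (R := R'.right)
      (S := TensorProduct R.right R'.right S.right)).mpr inferInstance
  · exact (RingHom.faithfullyFlat_algebraMap_iff (R := R'.right)
      (S := TensorProduct R.right R'.right S.right)).mpr inferInstance
  · exact Under.UnderMorphism.ext key

theorem IsEtaleCover.injective {k : Type u} [CommRing k] {R S : AlgOver k} {f : R ⟶ S}
    (hf : IsEtaleCover f) : Function.Injective f.right.hom :=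
  hf.2.injective

/-- Descent of functions along an étale covering. -/
theorem IsEtaleCover.descend {k : Type u} [CommRing k] {R S : AlgOver k} {f : R ⟶ S}
    (hf : IsEtaleCover f) (x : S.right)
    (h : ∀ (S' : AlgOver k) (i j : S ⟶ S'), f ≫ i = f ≫ j → i.right.hom x = j.right.hom x) :
    ∃ y : R.right, f.right.hom y = x := by
  let _ := f.right.hom.toAlgebra
  have _ : Module.FaithfullyFlat R.right S.right := hf.2
  have key : f.right ≫ CommRingCat.ofHom
        (algebraMap S.right (TensorProduct R.right S.right S.right)) =
      f.right ≫ CommRingCat.ofHom (Algebra.TensorProduct.includeRight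
        (R := R.right) (A := S.right) (B := S.right)).toRingHom := by
    ext x
    exact (((Algebra.TensorProduct.includeRight
      (R := R.right) (A := S.right) (B := S.right)).commutes x).symm)
  have h1 := Under.w f
  let S' : AlgOver k := Under.mk (S.hom ≫ CommRingCat.ofHom
    (algebraMap S.right (TensorProduct R.right S.right S.right)))
  let i : S ⟶ S' := Under.homMk (CommRingCat.ofHom (algebraMap _ _)) rfl
  let j : S ⟶ S' := Under.homMk (CommRingCat.ofHom (Algebra.TensorProduct.includeRight
      (R := R.right) (A := S.right) (B := S.right)).toRingHom) (by
    change S.hom ≫ _ = S.hom ≫ _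
    rw [← h1, Category.assoc, Category.assoc, key])
  have e := h S' i j (Under.UnderMorphism.ext key)
  have e' : Algebra.TensorProduct.includeLeftSubRight R.right S.right x = 0 := by
    rw [Algebra.TensorProduct.includeLeftSubRight_apply, sub_eq_zero]
    exact e
  exact (Algebra.IsEffective.of_faithfullyFlat R.right S.right x).mp e'

/-- Two `R`-points of `P` are `r`-related étale locally on `R`. -/
def LocRel {k : Type u} [CommRing k] {P : AlgOver k ⥤ Type w}
    (r : ∀ R : AlgOver k, P.obj R → P.obj R → Prop) {R : AlgOver k} (p q : P.obj R) : Prop :=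
  ∃ (S : AlgOver k) (f : R ⟶ S), IsEtaleCover f ∧ r S (P.map f p) (P.map f q)

/-- A section over `R` of the quotient sheaf `P / r` for the étale topology, where `r` is an
equivalence relation on the sheaf `P`: an equivalence class, that is, a subsheaf of `P` over `R`
which is stable under `r`, any two sections of which are `r`-related étale locally, and which has
a section étale locally on `R`. -/
@[ext]
structure QuotientSection {k : Type u} [CommRing k] (P : AlgOver k ⥤ Type w)
    (r : ∀ R : AlgOver k, P.obj R → P.obj R → Prop) (R : AlgOver k) where
  /-- the points of the class over each `R`-algebra `S` -/
  carrier : ∀ S : AlgOver k, (R ⟶ S) → Set (P.obj S)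
  map_mem : ∀ (S S' : AlgOver k) (f : R ⟶ S) (g : S ⟶ S') (p : P.obj S),
    p ∈ carrier S f → P.map g p ∈ carrier S' (f ≫ g)
  mem_of_cover : ∀ (S S' : AlgOver k) (f : R ⟶ S) (g : S ⟶ S') (p : P.obj S),
    IsEtaleCover g → P.map g p ∈ carrier S' (f ≫ g) → p ∈ carrier S f
  mem_of_rel : ∀ (S : AlgOver k) (f : R ⟶ S) (p q : P.obj S),
    p ∈ carrier S f → r S p q → q ∈ carrier S f
  locRel : ∀ (S : AlgOver k) (f : R ⟶ S) (p q : P.obj S),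
    p ∈ carrier S f → q ∈ carrier S f → LocRel r p q
  exists_cover : ∃ (S : AlgOver k) (f : R ⟶ S), IsEtaleCover f ∧ (carrier S f).Nonempty

/-- Restriction of a section of the quotient sheaf along `R ⟶ R'`. -/
def QuotientSection.restrict {k : Type u} [CommRing k] {P : AlgOver k ⥤ Type w}
    {r : ∀ R : AlgOver k, P.obj R → P.obj R → Prop} {R R' : AlgOver k} (h : R ⟶ R')
    (Z : QuotientSection P r R) : QuotientSection P r R' where
  carrier S f := Z.carrier S (h ≫ f)
  map_mem S S' f g p hp := by
    rw [← Category.assoc]; exact Z.map_mem S S' (h ≫ f) g p hp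
  mem_of_cover S S' f g p hg hp := by
    rw [← Category.assoc] at hp; exact Z.mem_of_cover S S' (h ≫ f) g p hg hp
  mem_of_rel S f p q hp hr := Z.mem_of_rel S (h ≫ f) p q hp hr
  locRel S f p q hp hq := Z.locRel S (h ≫ f) p q hp hq
  exists_cover := by
    obtain ⟨S, f, hf, p, hp⟩ := Z.exists_cover
    obtain ⟨S', f', g', hf', e⟩ := hf.baseChange h
    exact ⟨S', f', hf', P.map g' p, by rw [e]; exact Z.map_mem S S' f g' p hp⟩

/-- The quotient sheaf `P / r` for the étale topology. -/
def quotientSheaf {k : Type u} [CommRing k] (P : AlgOver k ⥤ Type w)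
    (r : ∀ R : AlgOver k, P.obj R → P.obj R → Prop) : AlgOver k ⥤ Type (max (u + 1) w) where
  obj R := QuotientSection P r R
  map h := ↾(QuotientSection.restrict h)
  map_id R := by
    refine ConcreteCategory.hom_ext _ _ fun Z => ?_
    refine QuotientSection.ext ?_
    funext S f
    change Z.carrier S (𝟙 R ≫ f) = Z.carrier S f
    rw [Category.id_comp]
  map_comp h h' := by
    refine ConcreteCategory.hom_ext _ _ fun Z => ?_
    refine QuotientSection.ext ?_
    funext S f
    change Z.carrier S ((h ≫ h') ≫ f) = Z.carrier S (h ≫ h' ≫ f)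
    rw [Category.assoc]

/-! ### The projective line with its action of `GL(2)` -/

/-- The punctured plane `𝔸² ∖ {0}`: pairs of elements that generate the unit ideal. -/
def puncturedPlane (k : Type u) [CommRing k] : AlgOver k ⥤ Type u where
  obj R := {v : Fin 2 → R.right // ∃ w : Fin 2 → R.right, w 0 * v 0 + w 1 * v 1 = 1}
  map f := ↾fun v => ⟨fun i => f.right.hom (v.1 i), by
    obtain ⟨w, hw⟩ := v.2
    exact ⟨fun i => f.right.hom (w i), by rw [← map_mul, ← map_mul, ← map_add, hw, map_one]⟩⟩
  map_id R := ConcreteCategory.hom_ext _ _ fun _ => Subtype.ext rfl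
  map_comp f g := ConcreteCategory.hom_ext _ _ fun _ => Subtype.ext rfl

/-- Proportionality: `v` and `v'` are in the same orbit of `𝔾ₘ`. -/
def proportional (k : Type u) [CommRing k] (R : AlgOver k) (v v' : (puncturedPlane k).obj R) :
    Prop :=
  ∃ c : R.rightˣ, v'.1 = fun i => (c : R.right) * v.1 i

/-- The projective line `ℙ¹ = (𝔸² ∖ {0}) / 𝔾ₘ` over `k`. -/
def projLine (k : Type u) [CommRing k] : AlgOver k ⥤ Type (u + 1) :=
  quotientSheaf (puncturedPlane k) (proportional k)

/-- The standard linear action of `GL(2)` on `𝔸² ∖ {0}`. -/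
def planeAct {k : Type u} [CommRing k] {R : AlgOver k} (g : GL (Fin 2) R.right)
    (v : (puncturedPlane k).obj R) : (puncturedPlane k).obj R :=
  ⟨(g : Matrix (Fin 2) (Fin 2) R.right).mulVec v.1, by
    obtain ⟨w, hw⟩ := v.2
    refine ⟨Matrix.vecMul w ((g⁻¹ : GL (Fin 2) R.right) : Matrix (Fin 2) (Fin 2) R.right), ?_⟩
    have h := Matrix.dotProduct_mulVec
      (Matrix.vecMul w ((g⁻¹ : GL (Fin 2) R.right) : Matrix (Fin 2) (Fin 2) R.right))
      (g : Matrix (Fin 2) (Fin 2) R.right) v.1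
    rw [Matrix.vecMul_vecMul, ← Units.val_mul, inv_mul_cancel, Units.val_one,
      Matrix.vecMul_one] at h
    simp only [dotProduct, Fin.sum_univ_two] at h
    rw [h, hw]⟩

theorem planeAct_map {k : Type u} [CommRing k] {R S : AlgOver k} (f : R ⟶ S)
    (g : GL (Fin 2) R.right) (v : (puncturedPlane k).obj R) :
    (puncturedPlane k).map f (planeAct g v) =
      planeAct (Matrix.GeneralLinearGroup.map f.right.hom g) ((puncturedPlane k).map f v) := by
  refine Subtype.ext (funext fun i => ?_)
  change f.right.hom ((g : Matrix (Fin 2) (Fin 2) R.right).mulVec v.1 i) =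
    (((g : Matrix (Fin 2) (Fin 2) R.right).map f.right.hom).mulVec
      (fun j => f.right.hom (v.1 j))) i
  simp only [Matrix.mulVec, dotProduct, Fin.sum_univ_two, map_add, map_mul, Matrix.map_apply]

theorem planeAct_proportional {k : Type u} [CommRing k] {R : AlgOver k}
    (g : GL (Fin 2) R.right) (v v' : (puncturedPlane k).obj R) (h : proportional k R v v') :
    proportional k R (planeAct g v) (planeAct g v') := by
  obtain ⟨c, hc⟩ := h
  refine ⟨c, funext fun i => ?_⟩
  change (g : Matrix (Fin 2) (Fin 2) R.right).mulVec v'.1 i =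
    c * (g : Matrix (Fin 2) (Fin 2) R.right).mulVec v.1 i
  rw [hc]
  simp only [Matrix.mulVec, dotProduct, Fin.sum_univ_two]
  ring

theorem planeAct_inv_act {k : Type u} [CommRing k] {R : AlgOver k}
    (g : GL (Fin 2) R.right) (v : (puncturedPlane k).obj R) :
    planeAct g (planeAct g⁻¹ v) = v := by
  refine Subtype.ext ?_
  change (g : Matrix (Fin 2) (Fin 2) R.right).mulVec
    (((g⁻¹ : GL (Fin 2) R.right) : Matrix (Fin 2) (Fin 2) R.right).mulVec v.1) = v.1
  rw [Matrix.mulVec_mulVec, ← Units.val_mul, mul_inv_cancel, Units.val_one, Matrix.one_mulVec]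

theorem planeAct_act_inv {k : Type u} [CommRing k] {R : AlgOver k}
    (g : GL (Fin 2) R.right) (v : (puncturedPlane k).obj R) :
    planeAct g⁻¹ (planeAct g v) = v := by
  have := planeAct_inv_act g⁻¹ v
  rwa [inv_inv] at this

/-- The left action of `GL(2)` (through `PGL(2)`) on `ℙ¹`: the class `gL` consists of the `v` such
that `g⁻¹ v` is in the class `L`. -/
def lineAct {k : Type u} [CommRing k] {R : AlgOver k} (g : GL (Fin 2) R.right)
    (L : (projLine k).obj R) : (projLine k).obj R where
  carrier S f := {v | planeAct (Matrix.GeneralLinearGroup.map f.right.hom g)⁻¹ v ∈ L.carrier S f}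
  map_mem S S' f h v hv := by
    have := L.map_mem S S' f h _ hv
    rw [planeAct_map, map_inv] at this
    exact this
  mem_of_cover S S' f h v hh hv := by
    refine L.mem_of_cover S S' f h _ hh ?_
    rw [planeAct_map, map_inv]
    exact hv
  mem_of_rel S f v v' hv hr :=
    L.mem_of_rel S f _ _ hv (planeAct_proportional _ v v' hr)
  locRel S f v v' hv hv' := by
    obtain ⟨S', h, hh, hr⟩ := L.locRel S f _ _ hv hv'
    refine ⟨S', h, hh, ?_⟩
    rw [planeAct_map, planeAct_map, map_inv] at hr
    have := planeAct_proportional (Matrix.GeneralLinearGroup.map h.right.hom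
      (Matrix.GeneralLinearGroup.map f.right.hom g)) _ _ hr
    rwa [planeAct_inv_act, planeAct_inv_act] at this
  exists_cover := by
    obtain ⟨S, f, hf, v, hv⟩ := L.exists_cover
    refine ⟨S, f, hf, planeAct (Matrix.GeneralLinearGroup.map f.right.hom g) v, ?_⟩
    change planeAct _⁻¹ (planeAct _ v) ∈ L.carrier S f
    rwa [planeAct_act_inv]

/-! ### The torsor `𝒯 ⟶ V` and the conic bundle `X ⟶ V` -/

/-- `F(s,t,u) = s² + t² + u² - stu - 4`. -/
def cayley {R : Type u} [CommRing R] (s t u : R) : R :=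
  s ^ 2 + t ^ 2 + u ^ 2 - s * t * u - 4

theorem cayley_map {R S : Type u} [CommRing R] [CommRing S] (f : R →+* S) (s t u : R) :
    f (cayley s t u) = cayley (f s) (f t) (f u) := by
  simp only [cayley, map_sub, map_add, map_mul, map_pow, map_ofNat]

/-- `V = 𝔸³ ∖ M₀`, the complement of the Cayley cubic `F(s,t,u) = 0`. -/
def traceSpace (k : Type u) [CommRing k] : AlgOver k ⥤ Type u where
  obj R := {p : R.right × R.right × R.right // IsUnit (cayley p.1 p.2.1 p.2.2)}
  map f := ↾fun p => ⟨(f.right.hom p.1.1, f.right.hom p.1.2.1, f.right.hom p.1.2.2), by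
    rw [← cayley_map]; exact p.2.map f.right.hom⟩
  map_id R := ConcreteCategory.hom_ext _ _ fun _ => Subtype.ext rfl
  map_comp f g := ConcreteCategory.hom_ext _ _ fun _ => Subtype.ext rfl

/-- The traces `(tr A, tr B, tr AB)` of a pair of matrices in `SL(2)`. -/
def traces {R : Type u} [CommRing R]
    (p : Matrix.SpecialLinearGroup (Fin 2) R × Matrix.SpecialLinearGroup (Fin 2) R) : R × R × R :=
  (p.1.1.trace, p.2.1.trace, (p.1.1 * p.2.1).trace)

theorem traces_map {R S : Type u} [CommRing R] [CommRing S] (f : R →+* S)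
    (p : Matrix.SpecialLinearGroup (Fin 2) R × Matrix.SpecialLinearGroup (Fin 2) R) :
    traces (Matrix.SpecialLinearGroup.map f p.1, Matrix.SpecialLinearGroup.map f p.2) =
      (f (traces p).1, f (traces p).2.1, f (traces p).2.2) := by
  simp [traces, Matrix.trace_fin_two, Matrix.mul_apply, Fin.sum_univ_two]

/-- `𝒯 = f⁻¹(V) ⊂ SL(2) × SL(2)`, where `f(A,B) = (tr A, tr B, tr AB)`. -/
def torsor (k : Type u) [CommRing k] : AlgOver k ⥤ Type u where
  obj R := {p : Matrix.SpecialLinearGroup (Fin 2) R.right ×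
      Matrix.SpecialLinearGroup (Fin 2) R.right //
    IsUnit (cayley (traces p).1 (traces p).2.1 (traces p).2.2)}
  map f := ↾fun p => ⟨(Matrix.SpecialLinearGroup.map f.right.hom p.1.1,
      Matrix.SpecialLinearGroup.map f.right.hom p.1.2), by
    rw [traces_map, ← cayley_map]; exact p.2.map f.right.hom⟩
  map_id R := ConcreteCategory.hom_ext _ _ fun _ => Subtype.ext rfl
  map_comp f g := ConcreteCategory.hom_ext _ _ fun _ => Subtype.ext rfl

/-- The morphism `f : 𝒯 ⟶ V` on points. -/
def torsorTraces {k : Type u} [CommRing k] {R : AlgOver k} (p : (torsor k).obj R) :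
    (traceSpace k).obj R := ⟨traces p.1, p.2⟩

theorem torsorTraces_map {k : Type u} [CommRing k] {R S : AlgOver k} (f : R ⟶ S)
    (p : (torsor k).obj R) :
    torsorTraces ((torsor k).map f p) = (traceSpace k).map f (torsorTraces p) :=
  Subtype.ext (traces_map f.right.hom p.1)

/-- The functor of points of `𝒯 × ℙ¹`. -/
def torsorProdLine (k : Type u) [CommRing k] : AlgOver k ⥤ Type (u + 1) where
  obj R := (torsor k).obj R × (projLine k).obj R
  map f := ↾fun p => ((torsor k).map f p.1, (projLine k).map f p.2)
  map_id R := by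
    refine ConcreteCategory.hom_ext _ _ fun p => ?_
    exact Prod.ext (ConcreteCategory.congr_hom ((torsor k).map_id R) p.1)
      (ConcreteCategory.congr_hom ((projLine k).map_id R) p.2)
  map_comp f g := by
    refine ConcreteCategory.hom_ext _ _ fun p => ?_
    exact Prod.ext (ConcreteCategory.congr_hom ((torsor k).map_comp f g) p.1)
      (ConcreteCategory.congr_hom ((projLine k).map_comp f g) p.2)

/-- Two points of `𝒯 × ℙ¹` are in the same orbit of the diagonal action of `PGL(2)`, by simultaneous
conjugation on `𝒯` and by the standard action on `ℙ¹`. Both actions are written as actions of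
`GL(2)`; as `GL(2) ⟶ PGL(2)` is an epimorphism of étale sheaves, this gives the same
quotient sheaf. -/
def sameOrbit (k : Type u) [CommRing k] (R : AlgOver k) (p q : (torsorProdLine k).obj R) : Prop :=
  ∃ g : GL (Fin 2) R.right,
    q.1.1.1.1 = g.1 * p.1.1.1.1 * (g⁻¹).1 ∧ q.1.1.2.1 = g.1 * p.1.1.2.1 * (g⁻¹).1 ∧
      q.2 = lineAct g p.2

/-- `X = (𝒯 × ℙ¹) / PGL(2)`. -/
def conicBundle (k : Type u) [CommRing k] : AlgOver k ⥤ Type (u + 1) :=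
  quotientSheaf (torsorProdLine k) (sameOrbit k)

theorem sameOrbit.traces_eq {k : Type u} [CommRing k] {R : AlgOver k}
    {p q : (torsorProdLine k).obj R} (h : sameOrbit k R p q) :
    torsorTraces p.1 = torsorTraces q.1 := by
  obtain ⟨g, hA, hB, -⟩ := h
  have hg : (g⁻¹).1 * g.1 = 1 := by rw [← Units.val_mul, inv_mul_cancel, Units.val_one]
  have conj : ∀ M : Matrix (Fin 2) (Fin 2) R.right,
      (g.1 * M * (g⁻¹).1).trace = M.trace := fun M => by
    rw [Matrix.trace_mul_comm, ← Matrix.mul_assoc, hg, Matrix.one_mul]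
  refine Subtype.ext (Prod.ext ?_ (Prod.ext ?_ ?_))
  · change p.1.1.1.1.trace = q.1.1.1.1.trace
    rw [hA, conj]
  · change p.1.1.2.1.trace = q.1.1.2.1.trace
    rw [hB, conj]
  · change (p.1.1.1.1 * p.1.1.2.1).trace = (q.1.1.1.1 * q.1.1.2.1).trace
    rw [hA, hB, ← conj (p.1.1.1.1 * p.1.1.2.1)]
    congr 1
    simp only [Matrix.mul_assoc]
    rw [← Matrix.mul_assoc (g⁻¹).1 g.1, hg, Matrix.one_mul]

/-- The point `v` of `V` is the image of the section `Z` of `X`: every point `((A, B), L)` of the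
class `Z` has traces `v`. -/
def LiesOver {k : Type u} [CommRing k] {R : AlgOver k} (Z : (conicBundle k).obj R)
    (v : (traceSpace k).obj R) : Prop :=
  ∀ (S : AlgOver k) (f : R ⟶ S) (p : (torsorProdLine k).obj S), p ∈ Z.carrier S f →
    torsorTraces p.1 = (traceSpace k).map f v

theorem traceSpace_map_injective {k : Type u} [CommRing k] {R S : AlgOver k} {f : R ⟶ S}
    (hf : IsEtaleCover f) : Function.Injective ((traceSpace k).map f) := by
  intro v v' h
  have h' := congrArg Subtype.val h
  exact Subtype.ext (Prod.ext (hf.injective (congrArg Prod.fst h'))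
    (Prod.ext (hf.injective (congrArg (fun q => q.2.1) h'))
      (hf.injective (congrArg (fun q => q.2.2) h'))))

theorem traces_eq_of_mem {k : Type u} [CommRing k] {R S : AlgOver k} {f : R ⟶ S}
    (Z : (conicBundle k).obj R) {p q : (torsorProdLine k).obj S} (hp : p ∈ Z.carrier S f)
    (hq : q ∈ Z.carrier S f) : torsorTraces p.1 = torsorTraces q.1 := by
  obtain ⟨S', g, hg, hr⟩ := Z.locRel S f p q hp hq
  refine traceSpace_map_injective hg ?_
  rw [← torsorTraces_map, ← torsorTraces_map]
  exact hr.traces_eq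

theorem exists_liesOver {k : Type u} [CommRing k] {R : AlgOver k} (Z : (conicBundle k).obj R) :
    ∃ v : (traceSpace k).obj R, LiesOver Z v := by
  obtain ⟨S, f, hf, p, hp⟩ := Z.exists_cover
  have main : ∀ (S' : AlgOver k) (i j : S ⟶ S'), f ≫ i = f ≫ j →
      (traceSpace k).map i (torsorTraces p.1) = (traceSpace k).map j (torsorTraces p.1) := by
    intro S' i j hij
    have hi := Z.map_mem S S' f i p hp
    have hj := Z.map_mem S S' f j p hp
    rw [← hij] at hj
    have := traces_eq_of_mem Z hi hj
    rw [← torsorTraces_map, ← torsorTraces_map]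
    exact this
  obtain ⟨a, ha⟩ := hf.descend (torsorTraces p.1).1.1 fun S' i j hij =>
    congrArg (fun q => q.1.1) (main S' i j hij)
  obtain ⟨b, hb⟩ := hf.descend (torsorTraces p.1).1.2.1 fun S' i j hij =>
    congrArg (fun q => q.1.2.1) (main S' i j hij)
  obtain ⟨c, hc⟩ := hf.descend (torsorTraces p.1).1.2.2 fun S' i j hij =>
    congrArg (fun q => q.1.2.2) (main S' i j hij)
  have hF : f.right.hom (cayley a b c) = cayley (torsorTraces p.1).1.1 (torsorTraces p.1).1.2.1
      (torsorTraces p.1).1.2.2 := by rw [cayley_map, ha, hb, hc]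
  obtain ⟨y, hy⟩ := (torsorTraces p.1).2.exists_right_inv
  rw [← hF] at hy
  obtain ⟨d, hd⟩ := hf.descend y fun S' i j hij => by
    have e : ∀ x : R.right, i.right.hom (f.right.hom x) = j.right.hom (f.right.hom x) := fun x =>
      congrArg (fun q : R ⟶ S' => q.right.hom x) hij
    have h1 := congrArg i.right.hom hy
    have h2 := congrArg j.right.hom hy
    rw [map_mul, map_one] at h1 h2
    rw [← e] at h2
    exact (left_inv_eq_right_inv ((mul_comm _ _).trans h1) h2)
  have hu : IsUnit (cayley a b c) := by
    refine IsUnit.of_mul_eq_one d (hf.injective ?_)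
    rw [map_mul, hd, hy, map_one]
  obtain ⟨v, hv⟩ : ∃ v : (traceSpace k).obj R, (traceSpace k).map f v = torsorTraces p.1 :=
    ⟨⟨(a, b, c), hu⟩, Subtype.ext (Prod.ext ha (Prod.ext hb hc))⟩
  refine ⟨v, fun S' g q hq => ?_⟩
  obtain ⟨S'', f', g', hf', e⟩ := hf.baseChange g
  have h1 := Z.map_mem S' S'' g f' q hq
  have h2 := Z.map_mem S S'' f g' p hp
  rw [← e] at h2
  have h3 := traces_eq_of_mem Z h1 h2
  refine traceSpace_map_injective hf' ?_
  rw [← torsorTraces_map]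
  refine h3.trans ((torsorTraces_map g' p.1).trans ?_)
  rw [← hv, ← Functor.map_comp_apply, ← Functor.map_comp_apply, e]

/-- The morphism `X ⟶ V` on points, induced by `f : 𝒯 ⟶ V`. -/
def bundleProj {k : Type u} [CommRing k] {R : AlgOver k} (Z : (conicBundle k).obj R) :
    (traceSpace k).obj R :=
  (exists_liesOver Z).choose

theorem bundleProj_eq_iff {k : Type u} [CommRing k] {R : AlgOver k} (Z : (conicBundle k).obj R)
    (v : (traceSpace k).obj R) : bundleProj Z = v ↔ LiesOver Z v := by
  have h0 : LiesOver Z (bundleProj Z) := (exists_liesOver Z).choose_spec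
  refine ⟨fun h => h ▸ h0, fun h => ?_⟩
  obtain ⟨S, f, hf, p, hp⟩ := Z.exists_cover
  exact traceSpace_map_injective hf ((h0 S f p hp).symm.trans (h S f p hp))

theorem bundleProj_map {k : Type u} [CommRing k] {R R' : AlgOver k} (h : R ⟶ R')
    (Z : (conicBundle k).obj R) :
    bundleProj ((conicBundle k).map h Z) = (traceSpace k).map h (bundleProj Z) := by
  rw [bundleProj_eq_iff]
  intro S f p hp
  rw [← Functor.map_comp_apply]
  exact (bundleProj_eq_iff Z _).mp rfl S (h ≫ f) p hp

/-! ### The generic fibre -/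

/-- `K = k(s,t,u)`, the function field of `𝔸³`. -/
abbrev FunField (k : Type u) [Field k] : Type u := FractionRing (MvPolynomial (Fin 3) k)

/-- The coordinate functions `s`, `t`, `u` (for `i = 0, 1, 2`) in `K`. -/
def coord (k : Type u) [Field k] (i : Fin 3) : FunField k :=
  algebraMap (MvPolynomial (Fin 3) k) (FunField k) (MvPolynomial.X i)

theorem cayley_coord_ne_zero (k : Type u) [Field k] [CharZero k] :
    cayley (coord k 0) (coord k 1) (coord k 2) ≠ 0 := by
  unfold coord
  rw [← cayley_map]
  refine (map_ne_zero_iff _ (IsFractionRing.injective _ _)).mpr fun h => ?_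
  have := congrArg (MvPolynomial.eval (fun _ => (0 : k))) h
  rw [cayley_map] at this
  simp [cayley] at this

theorem coord_sq_sub_four_ne_zero (k : Type u) [Field k] [CharZero k] :
    coord k 1 ^ 2 - 4 ≠ 0 := by
  have e : coord k 1 ^ 2 - 4 = algebraMap (MvPolynomial (Fin 3) k) (FunField k)
      (MvPolynomial.X 1 ^ 2 - 4) := by
    simp only [coord, map_sub, map_pow, map_ofNat]
  rw [e]
  refine (map_ne_zero_iff _ (IsFractionRing.injective _ _)).mpr fun h => ?_
  have := congrArg (MvPolynomial.eval (fun _ => (0 : k))) h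
  simp only [map_sub, map_pow, map_ofNat, MvPolynomial.eval_X, map_zero] at this
  norm_num at this

/-- For an extension `K` of `k`, a `K`-algebra regarded as a `k`-algebra. -/
abbrev restrictBase (k K : Type u) [CommRing k] [CommRing K] [Algebra k K] :
    AlgOver K ⥤ AlgOver k :=
  Under.map (CommRingCat.ofHom (algebraMap k K))

/-- The generic point `(s,t,u)` of `V`, as a point over a given `K`-algebra `R`. -/
def genericPoint (k : Type u) [Field k] [CharZero k] (R : AlgOver (FunField k)) :
    (traceSpace k).obj ((restrictBase k (FunField k)).obj R) :=
  ⟨(R.hom.hom (coord k 0), R.hom.hom (coord k 1), R.hom.hom (coord k 2)), by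
    have := ((cayley_coord_ne_zero k).isUnit).map R.hom.hom
    rwa [cayley_map] at this⟩

theorem genericPoint_map (k : Type u) [Field k] [CharZero k] {R R' : AlgOver (FunField k)}
    (f : R ⟶ R') :
    (traceSpace k).map ((restrictBase k (FunField k)).map f) (genericPoint k R) =
      genericPoint k R' := by
  have h : ∀ x : FunField k, f.right.hom (R.hom.hom x) = R'.hom.hom x := fun x =>
    congrArg (fun q : CommRingCat.of (FunField k) ⟶ R'.right => q.hom x) (Under.w f)
  exact Subtype.ext (Prod.ext (h _) (Prod.ext (h _) (h _)))

/-- The generic fibre `X_K = X ×_V Spec K` of `X ⟶ V`. -/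
def genericFibre (k : Type u) [Field k] [CharZero k] : AlgOver (FunField k) ⥤ Type (u + 1) where
  obj R := {Z : (conicBundle k).obj ((restrictBase k (FunField k)).obj R) //
    bundleProj Z = genericPoint k R}
  map f := ↾fun Z => ⟨(conicBundle k).map ((restrictBase k (FunField k)).map f) Z.1, by
    rw [bundleProj_map, Z.2, genericPoint_map]⟩
  map_id R := ConcreteCategory.hom_ext _ _ fun Z => Subtype.ext (by
    change (conicBundle k).map ((restrictBase k (FunField k)).map (𝟙 R)) Z.1 = Z.1
    rw [CategoryTheory.Functor.map_id, CategoryTheory.Functor.map_id]; rfl)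
  map_comp f g := ConcreteCategory.hom_ext _ _ fun Z => Subtype.ext (by
    change (conicBundle k).map ((restrictBase k (FunField k)).map (f ≫ g)) Z.1 = _
    rw [Functor.map_comp, Functor.map_comp]; rfl)

/-! ### Galois cohomology with coefficients in `μ₂` -/

/-- The group `μ₂` of square roots of unity in an algebraic closure of `K`. -/
abbrev MuTwo (K : Type u) [Field K] : Type u := rootsOfUnity 2 (AlgebraicClosure K)

/-- The action of the absolute Galois group on `μ₂`. -/
def galMu {K : Type u} [Field K] (σ : Gal(AlgebraicClosure K/K)) : MuTwo K →* MuTwo K :=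
  restrictRootsOfUnity σ 2

/-- Continuous (that is, locally constant) 2-cocycles of the absolute Galois group of `K` with
values in `μ₂`. -/
def twoCocycles (K : Type u) [Field K] :
    Subgroup (Gal(AlgebraicClosure K/K) × Gal(AlgebraicClosure K/K) → MuTwo K) where
  carrier := {a | IsLocallyConstant a ∧ ∀ σ τ ρ,
    galMu σ (a (τ, ρ)) * a (σ, τ * ρ) = a (σ * τ, ρ) * a (σ, τ)}
  one_mem' := ⟨IsLocallyConstant.const 1, fun σ τ ρ => by simp⟩
  mul_mem' {a b} ha hb := ⟨ha.1.mul hb.1, fun σ τ ρ => by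
    simp only [Pi.mul_apply, map_mul]
    rw [mul_mul_mul_comm, ha.2, hb.2, mul_mul_mul_comm]⟩
  inv_mem' {a} ha := ⟨ha.1.inv, fun σ τ ρ => by
    simp only [Pi.inv_apply, map_inv]
    rw [← mul_inv, ha.2, mul_inv]⟩

/-- Coboundaries of locally constant 1-cochains. -/
def twoCoboundaries (K : Type u) [Field K] :
    Subgroup (Gal(AlgebraicClosure K/K) × Gal(AlgebraicClosure K/K) → MuTwo K) where
  carrier := {a | ∃ b : Gal(AlgebraicClosure K/K) → MuTwo K, IsLocallyConstant b ∧
    ∀ σ τ, a (σ, τ) = galMu σ (b τ) * (b (σ * τ))⁻¹ * b σ}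
  one_mem' := ⟨1, IsLocallyConstant.const 1, fun σ τ => by simp⟩
  mul_mem' := by
    rintro a a' ⟨b, hb, h⟩ ⟨b', hb', h'⟩
    refine ⟨b * b', hb.mul hb', fun σ τ => ?_⟩
    simp only [Pi.mul_apply, map_mul, h, h', mul_inv]
    rw [mul_mul_mul_comm, mul_mul_mul_comm (galMu σ (b τ))]
  inv_mem' := by
    rintro a ⟨b, hb, h⟩
    refine ⟨b⁻¹, hb.inv, fun σ τ => ?_⟩
    simp only [Pi.inv_apply, map_inv, h, mul_inv]

/-- The Galois cohomology group `H²(K, μ₂)` (written multiplicatively). -/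
abbrev H2 (K : Type u) [Field K] : Type u :=
  twoCocycles K ⧸ (twoCoboundaries K).subgroupOf (twoCocycles K)

theorem exists_sqrt {K : Type u} [Field K] (a : Kˣ) :
    ∃ α : (AlgebraicClosure K)ˣ, (α : AlgebraicClosure K) ^ 2 = algebraMap K _ a := by
  obtain ⟨α, h⟩ := IsAlgClosed.exists_pow_nat_eq (algebraMap K (AlgebraicClosure K) a) two_pos
  have h0 : α ≠ 0 := by
    rintro rfl
    have : algebraMap K (AlgebraicClosure K) a ≠ 0 := by simp
    exact this (by rw [← h]; simp)
  exact ⟨Units.mk0 α h0, h⟩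

/-- A square root of `a` in the algebraic closure. -/
def sqrtUnit {K : Type u} [Field K] (a : Kˣ) : (AlgebraicClosure K)ˣ := (exists_sqrt a).choose

theorem sqrtUnit_sq {K : Type u} [Field K] (a : Kˣ) :
    (sqrtUnit a : AlgebraicClosure K) ^ 2 = algebraMap K _ a := (exists_sqrt a).choose_spec

/-- The Kummer cocycle `σ ↦ σ(√a) / √a` of `a`, with values in `μ₂`. -/
def kummer {K : Type u} [Field K] (a : Kˣ) (σ : Gal(AlgebraicClosure K/K)) : MuTwo K :=
  ⟨Units.map (σ : AlgebraicClosure K →* AlgebraicClosure K) (sqrtUnit a) * (sqrtUnit a)⁻¹, by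
    rw [mem_rootsOfUnity, mul_pow, inv_pow, mul_inv_eq_one]
    ext
    simp only [Units.val_pow_eq_pow_val, Units.coe_map, MonoidHom.coe_coe]
    rw [← map_pow, sqrtUnit_sq, AlgEquiv.commutes]⟩

open Classical in
/-- The pairing `μ₂ × μ₂ ⟶ μ₂` that identifies `μ₂ ⊗ μ₂` with `μ₂`: it sends `(-1, -1)` to `-1` and
`(1, y)` and `(x, 1)` to `1`. -/
def muPairing {K : Type u} [Field K] (x y : MuTwo K) : MuTwo K := if x = 1 then 1 else y

theorem muTwo_mul_self {K : Type u} [Field K] (x : MuTwo K) : x * x = 1 := by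
  have h := (mem_rootsOfUnity 2 _).mp x.2
  exact Subtype.ext (by rw [Subgroup.coe_mul, ← pow_two]; exact h)

theorem muTwo_eq_or {K : Type u} [Field K] (x : MuTwo K) :
    x = 1 ∨ ((x : (AlgebraicClosure K)ˣ) : AlgebraicClosure K) = -1 := by
  have h := congrArg (fun y : MuTwo K => ((y : (AlgebraicClosure K)ˣ) : AlgebraicClosure K))
    (muTwo_mul_self x)
  rcases mul_self_eq_one_iff.mp (show ((x : (AlgebraicClosure K)ˣ) : AlgebraicClosure K) *
    ((x : (AlgebraicClosure K)ˣ) : AlgebraicClosure K) = 1 from h) with h | h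
  · exact Or.inl (Subtype.ext (Units.ext h))
  · exact Or.inr h

theorem galMu_apply {K : Type u} [Field K] (σ : Gal(AlgebraicClosure K/K)) (x : MuTwo K) :
    galMu σ x = x := by
  rcases muTwo_eq_or x with rfl | h
  · exact map_one _
  · refine Subtype.ext (Units.ext ?_)
    change σ ((x : (AlgebraicClosure K)ˣ) : AlgebraicClosure K) = _
    rw [h, map_neg, map_one]

theorem muPairing_mul_right {K : Type u} [Field K] (x y y' : MuTwo K) :
    muPairing x (y * y') = muPairing x y * muPairing x y' := by
  unfold muPairing
  split_ifs <;> simp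

theorem muPairing_mul_left {K : Type u} [Field K] (x x' y : MuTwo K) :
    muPairing (x * x') y = muPairing x y * muPairing x' y := by
  have key : x ≠ 1 → x' ≠ 1 → x * x' = 1 := fun h h' => by
    have e := (muTwo_eq_or x).resolve_left h
    have e' := (muTwo_eq_or x').resolve_left h'
    refine Subtype.ext (Units.ext ?_)
    change ((x : (AlgebraicClosure K)ˣ) : AlgebraicClosure K) *
      ((x' : (AlgebraicClosure K)ˣ) : AlgebraicClosure K) = 1
    rw [e, e']; ring
  by_cases h : x = 1
  · rw [h, one_mul, show muPairing 1 y = 1 from if_pos rfl, one_mul]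
  · by_cases h' : x' = 1
    · simp [muPairing, h, h']
    · simp [muPairing, h, h', key h h', muTwo_mul_self]

theorem kummer_mul {K : Type u} [Field K] (a : Kˣ) (σ τ : Gal(AlgebraicClosure K/K)) :
    kummer a (σ * τ) = kummer a σ * kummer a τ := by
  conv_rhs => rw [← galMu_apply σ (kummer a τ)]
  refine Subtype.ext (Units.ext ?_)
  change σ (τ (sqrtUnit a : AlgebraicClosure K)) * (((sqrtUnit a)⁻¹ : (AlgebraicClosure K)ˣ) :
      AlgebraicClosure K) =
    σ (sqrtUnit a : AlgebraicClosure K) * (((sqrtUnit a)⁻¹ : (AlgebraicClosure K)ˣ) :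
      AlgebraicClosure K) *
    σ (τ (sqrtUnit a : AlgebraicClosure K) * (((sqrtUnit a)⁻¹ : (AlgebraicClosure K)ˣ) :
      AlgebraicClosure K))
  have h : σ (sqrtUnit a : AlgebraicClosure K) *
      σ (((sqrtUnit a)⁻¹ : (AlgebraicClosure K)ˣ) : AlgebraicClosure K) = 1 := by
    rw [← map_mul, Units.mul_inv, map_one]
  rw [map_mul]
  linear_combination (-(σ (τ (sqrtUnit a : AlgebraicClosure K)) *
    (((sqrtUnit a)⁻¹ : (AlgebraicClosure K)ˣ) : AlgebraicClosure K))) * h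

theorem kummer_isLocallyConstant {K : Type u} [Field K] (a : Kˣ) :
    IsLocallyConstant (kummer a) := by
  rw [IsLocallyConstant.iff_exists_open]
  intro σ
  have ho := stabilizer_isOpen_of_isIntegral (K := K) (sqrtUnit a : AlgebraicClosure K)
  refine ⟨(fun τ => σ⁻¹ * τ) ⁻¹' (MulAction.stabilizer Gal(AlgebraicClosure K/K)
    (sqrtUnit a : AlgebraicClosure K) : Set Gal(AlgebraicClosure K/K)),
    ho.preimage (continuous_const_mul σ⁻¹), ?_, fun τ hτ => ?_⟩
  · change σ⁻¹ * σ ∈ MulAction.stabilizer _ _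
    rw [inv_mul_cancel]; exact one_mem _
  · have h1 : kummer a (σ⁻¹ * τ) = 1 := by
      refine Subtype.ext (Units.ext ?_)
      change (σ⁻¹ * τ) (sqrtUnit a : AlgebraicClosure K) *
        (((sqrtUnit a)⁻¹ : (AlgebraicClosure K)ˣ) : AlgebraicClosure K) = 1
      rw [show (σ⁻¹ * τ) (sqrtUnit a : AlgebraicClosure K) = (sqrtUnit a : AlgebraicClosure K)
        from hτ, Units.mul_inv]
    have h2 := kummer_mul a σ (σ⁻¹ * τ)
    rwa [mul_inv_cancel_left, h1, mul_one] at h2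

/-- The quaternion symbol `(a, b) ∈ H²(K, μ₂)`: the cup product
`(σ, τ) ↦ χ_a(σ) ⊗ σ(χ_b(τ))` of the Kummer classes of `a` and `b`. -/
def symbol {K : Type u} [Field K] (a b : Kˣ) : H2 K :=
  QuotientGroup.mk ⟨fun p => muPairing (kummer a p.1) (galMu p.1 (kummer b p.2)), by
    refine ⟨?_, fun σ τ ρ => ?_⟩
    · simp only [galMu_apply]
      exact ((kummer_isLocallyConstant a).comp_continuous continuous_fst).comp₂
        ((kummer_isLocallyConstant b).comp_continuous continuous_snd) muPairing
    · simp only [galMu_apply, kummer_mul, muPairing_mul_left, muPairing_mul_right]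
      rw [mul_comm, mul_right_comm, mul_comm (muPairing (kummer a σ) (kummer b τ)),
        mul_right_comm]
      ac_rfl⟩

/-! ### The class of a Severi–Brauer curve -/

/-- The algebraic closure of `K` as an algebra over `K`. -/
abbrev closurePt (K : Type u) [Field K] : AlgOver K :=
  (restrictBase K (AlgebraicClosure K)).obj (Under.mk (𝟙 (CommRingCat.of (AlgebraicClosure K))))

/-- An element of the absolute Galois group as a morphism of `K`-algebras. -/
def galHom {K : Type u} [Field K] (σ : Gal(AlgebraicClosure K/K)) : closurePt K ⟶ closurePt K :=
  Under.homMk (CommRingCat.ofHom (σ : AlgebraicClosure K →+* AlgebraicClosure K)) (by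
    ext x
    exact σ.commutes x)

/-- For a field `K` of characteristic zero, `c ∈ H²(K, μ₂)` is the class `[Y]` of the form `Y` of
`ℙ¹` (a smooth projective conic) over `K`: there is an isomorphism
`φ : ℙ¹ ⟶ Y` over the algebraic closure `K̄`, and a continuous lift `g : Gal ⟶ SL(2, K̄)` of the
1-cocycle `σ ↦ φ⁻¹ ∘ σ(φ)` of `Y` with values in `PGL(2, K̄) = Aut(ℙ¹)`, such that `c` is
the class of the 2-cocycle `(σ, τ) ↦ g(σ) σ(g(τ)) g(στ)⁻¹`, that is, the image of the class of `Y`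
under the connecting map `H¹(K, PGL(2)) ⟶ H²(K, μ₂)` of `1 ⟶ μ₂ ⟶ SL(2) ⟶ PGL(2) ⟶ 1`.
The equality `σ(φ) = φ ∘ g(σ)` is expressed on `K̄`-points, as `σ(φ(L)) = φ(g(σ) σ(L))`. -/
def HasBrauerClass {K : Type u} [Field K] (Y : AlgOver K ⥤ Type (u + 1)) (c : H2 K) : Prop :=
  ∃ (φ : restrictBase K (AlgebraicClosure K) ⋙ projLine K ≅
        restrictBase K (AlgebraicClosure K) ⋙ Y)
    (g : Gal(AlgebraicClosure K/K) → Matrix.SpecialLinearGroup (Fin 2) (AlgebraicClosure K))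
    (a : twoCocycles K),
    IsLocallyConstant g ∧
    (∀ (σ : Gal(AlgebraicClosure K/K)) (L : (projLine K).obj (closurePt K)),
      Y.map (galHom σ) (φ.hom.app (Under.mk (𝟙 (CommRingCat.of (AlgebraicClosure K)))) L) =
        φ.hom.app (Under.mk (𝟙 (CommRingCat.of (AlgebraicClosure K))))
          (lineAct (R := closurePt K) (Matrix.SpecialLinearGroup.toGL (g σ))
            ((projLine K).map (galHom σ) L))) ∧
    (∀ σ τ : Gal(AlgebraicClosure K/K),
      (g σ * Matrix.SpecialLinearGroup.map (σ : AlgebraicClosure K →+* AlgebraicClosure K)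
          (g τ)).1 =
        ((a.1 (σ, τ) : (AlgebraicClosure K)ˣ) : AlgebraicClosure K) • (g (σ * τ)).1) ∧
    c = QuotientGroup.mk a

end

end TraceConic

/-!
For `(A, B)` in `𝒯` the determinant of `A * B - B * A` is `-F`, which is invertible, so `1`, `A`,
`B`, `A * B` is a basis of the algebra of 2 × 2 matrices. Hence two points of `𝒯` with the same
traces differ by an endomorphism of this algebra, which is conjugation by an invertible matrix
locally for the Zariski topology, and only scalars commute with `A` and `B`. So `PGL(2)` acts
simply transitively on the fibres of `𝒯 ⟶ V`, and a point `T` of `𝒯` over `K̄` above `(s, t, u)`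
trivializes the conic.

Choose `T = (A, B)` with `B` diagonal, with eigenvalues `(t ± α) / 2` where `α = √(t² - 4)`, and
with `A` of upper right entry `1` and hence of lower left entry `-F / α²`. An element of the Galois
group that fixes `α` fixes `T`; one that changes its sign sends `T` to a pair conjugate to it by
`!![0, 1; -F / α², 0]`. Dividing this matrix by the square root `√F / α` of its determinant lifts
the cocycle to `SL(2)`, and the coboundary of the lift is the cup product of the Kummer cocycles of
`t² - 4` and `F`.
-/

namespace TraceConic

open CategoryTheory

noncomputable section

theorem IsEtaleCover.id {k : Type u} [CommRing k] (R : AlgOver k) : IsEtaleCover (𝟙 R) :=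
  ⟨RingHom.Etale.of_bijective Function.bijective_id,
    RingHom.FaithfullyFlat.of_bijective Function.bijective_id⟩

theorem IsEtaleCover.comp {k : Type u} [CommRing k] {R S T : AlgOver k} {f : R ⟶ S} {g : S ⟶ T}
    (hf : IsEtaleCover f) (hg : IsEtaleCover g) : IsEtaleCover (f ≫ g) :=
  ⟨RingHom.Etale.stableUnderComposition _ _ hf.1 hg.1,
    RingHom.FaithfullyFlat.stableUnderComposition _ _ hf.2 hg.2⟩

theorem faithfullyFlat_pi_localizationAway {R : Type*} [CommRing R] {ι : Type*} [Finite ι]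
    {d : ι → R} (hd : Ideal.span (Set.range d) = ⊤) :
    Module.FaithfullyFlat R (∀ i, Localization.Away (d i)) := by
  have : Module.Flat R (∀ i, Localization.Away (d i)) := inferInstance
  refine Module.FaithfullyFlat.of_comap_surjective fun P => ?_
  obtain ⟨i, hi⟩ : ∃ i, d i ∉ P.asIdeal := by
    by_contra! h
    exact P.2.ne_top (top_le_iff.mp (hd ▸ Ideal.span_le.mpr (Set.range_subset_iff.mpr h)))
  obtain ⟨Q, rfl⟩ : P ∈ Set.range
      (PrimeSpectrum.comap (algebraMap R (Localization.Away (d i)))) := by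
    rw [PrimeSpectrum.localization_away_comap_range _ (d i)]
    exact hi
  exact ⟨PrimeSpectrum.comap (Pi.evalRingHom _ i) Q, rfl⟩

section ZariskiCover

variable {k : Type u} [CommRing k] {R : AlgOver k} {ι : Type}

/-- The disjoint union of the basic open subsets `D(dᵢ)` of `Spec R`, that is, the product of the
localizations of `R` at the `dᵢ`. -/
def awayProd (d : ι → R.right) : AlgOver k :=
  Under.mk (R.hom ≫ CommRingCat.ofHom (algebraMap R.right (∀ i, Localization.Away (d i))))

/-- The morphism `R ⟶ ∏ R[1/dᵢ]`. -/
def toAwayProd (d : ι → R.right) : R ⟶ awayProd d :=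
  Under.homMk (CommRingCat.ofHom (algebraMap R.right (∀ i, Localization.Away (d i)))) rfl

theorem isEtaleCover_toAwayProd [Finite ι] {d : ι → R.right}
    (hd : Ideal.span (Set.range d) = ⊤) : IsEtaleCover (toAwayProd d) := by
  have (i : ι) : Algebra.Etale R.right (Localization.Away (d i)) := .of_isLocalizationAway (d i)
  exact ⟨RingHom.etale_algebraMap (S := ∀ i, Localization.Away (d i)).mpr inferInstance,
    RingHom.faithfullyFlat_algebraMap_iff.mpr (faithfullyFlat_pi_localizationAway hd)⟩

end ZariskiCover

/-- An equivalence relation on the functor of points `P`: an equivalence relation on the points over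
each algebra that is preserved by the restriction maps. -/
structure IsEquivRel {k : Type u} [CommRing k] (P : AlgOver k ⥤ Type w)
    (r : ∀ R : AlgOver k, P.obj R → P.obj R → Prop) : Prop where
  equiv : ∀ R, Equivalence (r R)
  map : ∀ {R S : AlgOver k} (f : R ⟶ S) {p q : P.obj R}, r R p q → r S (P.map f p) (P.map f q)

section QuotientSheaf

variable {k : Type u} [CommRing k] {P : AlgOver k ⥤ Type w}
  {r : ∀ R : AlgOver k, P.obj R → P.obj R → Prop} {R S : AlgOver k}

theorem LocRel.of_rel {p q : P.obj R} (h : r R p q) : LocRel r p q :=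
  ⟨R, 𝟙 R, .id R, by simpa using h⟩

theorem LocRel.symm (hr : IsEquivRel P r) {p q : P.obj R} (h : LocRel r p q) : LocRel r q p := by
  obtain ⟨S, f, hf, h⟩ := h
  exact ⟨S, f, hf, (hr.equiv S).symm h⟩

theorem LocRel.map (hr : IsEquivRel P r) (f : R ⟶ S) {p q : P.obj R} (h : LocRel r p q) :
    LocRel r (P.map f p) (P.map f q) := by
  obtain ⟨S', g, hg, h⟩ := h
  obtain ⟨T, g', f', hg', e⟩ := hg.baseChange f
  refine ⟨T, g', hg', ?_⟩
  rw [← Functor.map_comp_apply, ← Functor.map_comp_apply, e, Functor.map_comp_apply,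
    Functor.map_comp_apply]
  exact hr.map f' h

theorem LocRel.of_cover {f : R ⟶ S} (hf : IsEtaleCover f) {p q : P.obj R}
    (h : LocRel r (P.map f p) (P.map f q)) : LocRel r p q := by
  obtain ⟨T, g, hg, h⟩ := h
  refine ⟨T, f ≫ g, hf.comp hg, ?_⟩
  rwa [Functor.map_comp_apply, Functor.map_comp_apply]

theorem LocRel.trans (hr : IsEquivRel P r) {p q q' : P.obj R} (h : LocRel r p q)
    (hq : LocRel r q q') : LocRel r p q' := by
  obtain ⟨S, f, hf, h⟩ := h
  obtain ⟨T, g, hg, hq⟩ := hq.map hr f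
  refine .of_cover (hf.comp hg) (.of_rel ?_)
  rw [Functor.map_comp_apply, Functor.map_comp_apply]
  exact (hr.equiv T).trans (hr.map g h) hq

namespace QuotientSection

/-- The class of a point of `P` in the quotient sheaf `P / r`. -/
def classOf (hr : IsEquivRel P r) (p : P.obj R) : QuotientSection P r R where
  carrier S f := {q | LocRel r (P.map f p) q}
  map_mem S S' f g q hq := by
    simpa only [Set.mem_ofPred_eq, Functor.map_comp_apply] using LocRel.map hr g hq
  mem_of_cover S S' f g q hg hq := by
    simp only [Set.mem_ofPred_eq, Functor.map_comp_apply] at hq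
    exact hq.of_cover hg
  mem_of_rel S f q q' hq h := LocRel.trans hr hq (.of_rel h)
  locRel S f q q' hq hq' := (LocRel.symm hr hq).trans hr hq'
  exists_cover := ⟨R, 𝟙 R, .id R, P.map (𝟙 R) p, .of_rel ((hr.equiv R).refl _)⟩

theorem mem_of_locRel (Z : QuotientSection P r R) {f : R ⟶ S} {p q : P.obj S}
    (hp : p ∈ Z.carrier S f) (h : LocRel r p q) : q ∈ Z.carrier S f := by
  obtain ⟨T, g, hg, h⟩ := h
  exact Z.mem_of_cover S T f g q hg (Z.mem_of_rel _ _ _ _ (Z.map_mem S T f g p hp) h)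

theorem eq_of_mem {Z Z' : QuotientSection P r R} {f : R ⟶ S} (hf : IsEtaleCover f) {p : P.obj S}
    (hp : p ∈ Z.carrier S f) (hp' : p ∈ Z'.carrier S f) : Z = Z' := by
  have carrier_subset : ∀ {Z Z' : QuotientSection P r R}, p ∈ Z.carrier S f →
      p ∈ Z'.carrier S f → ∀ (T : AlgOver k) (g : R ⟶ T), Z.carrier T g ⊆ Z'.carrier T g := by
    intro Z Z' hp hp' T g q hq
    obtain ⟨T', f', g', hf', e⟩ := hf.baseChange g
    have hq' := Z.map_mem T T' g f' q hq
    have hZ := Z.map_mem S T' f g' p hp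
    have hZ' := Z'.map_mem S T' f g' p hp'
    rw [← e] at hZ hZ'
    exact Z'.mem_of_cover T T' g f' q hf' (Z'.mem_of_locRel hZ' (Z.locRel _ _ _ _ hZ hq'))
  exact QuotientSection.ext (funext fun T => funext fun g =>
    (carrier_subset hp hp' T g).antisymm (carrier_subset hp' hp T g))

theorem mem_classOf (hr : IsEquivRel P r) (p : P.obj R) : p ∈ (classOf hr p).carrier R (𝟙 R) :=
  .of_rel (by rw [Functor.map_id_apply]; exact (hr.equiv R).refl p)

theorem classOf_eq_iff (hr : IsEquivRel P r) (p : P.obj R) (Z : QuotientSection P r R) :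
    classOf hr p = Z ↔ p ∈ Z.carrier R (𝟙 R) :=
  ⟨fun h => h ▸ mem_classOf hr p, fun h => eq_of_mem (.id R) (mem_classOf hr p) h⟩

theorem classOf_eq_classOf_iff (hr : IsEquivRel P r) (p q : P.obj R) :
    classOf hr p = classOf hr q ↔ LocRel r q p := by
  rw [classOf_eq_iff]
  change LocRel r (P.map (𝟙 R) q) p ↔ _
  rw [Functor.map_id_apply]

theorem restrict_classOf (hr : IsEquivRel P r) (f : R ⟶ S) (p : P.obj R) :
    (classOf hr p).restrict f = classOf hr (P.map f p) := by
  refine QuotientSection.ext (funext fun T => funext fun g => ?_)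
  change {q | LocRel r (P.map (f ≫ g) p) q} = {q | LocRel r (P.map g (P.map f p)) q}
  rw [Functor.map_comp_apply]

theorem restrict_eq_classOf (hr : IsEquivRel P r) (Z : QuotientSection P r R) {f : R ⟶ S}
    {p : P.obj S} (hp : p ∈ Z.carrier S f) : Z.restrict f = classOf hr p := by
  refine ((classOf_eq_iff hr p _).mpr ?_).symm
  change p ∈ Z.carrier S (f ≫ 𝟙 S)
  rwa [Category.comp_id]

theorem restrict_injective {f : R ⟶ S} (hf : IsEtaleCover f) :
    Function.Injective (restrict f : QuotientSection P r R → _) := by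
  intro Z Z' h
  obtain ⟨T, g, hg, p, hp⟩ := (Z.restrict f).exists_cover
  exact eq_of_mem (hf.comp hg) hp (h ▸ hp : p ∈ (Z'.restrict f).carrier T g)

theorem mem_carrier_of_restrict_eq {W : QuotientSection P r R} {f g : R ⟶ S}
    (h : W.restrict f = W.restrict g) {p : P.obj S} (hp : p ∈ W.carrier S f) :
    p ∈ W.carrier S g := by
  have : (W.restrict f).carrier S (𝟙 S) = (W.restrict g).carrier S (𝟙 S) := by rw [h]
  change W.carrier S (f ≫ 𝟙 S) = W.carrier S (g ≫ 𝟙 S) at this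
  rw [Category.comp_id, Category.comp_id] at this
  exact this ▸ hp

theorem exists_restrict_eq (hr : IsEquivRel P r) {f : R ⟶ S} (hf : IsEtaleCover f)
    (W : QuotientSection P r S)
    (hW : ∀ (T : AlgOver k) (i j : S ⟶ T), f ≫ i = f ≫ j → W.restrict i = W.restrict j) :
    ∃ Z : QuotientSection P r R, Z.restrict f = W := by
  have map_mem_of_comp_eq : ∀ {T T' : AlgOver k} {h : S ⟶ T} {h' : T ⟶ T'} {i : S ⟶ T'}
      {p : P.obj T}, p ∈ W.carrier T h → (f ≫ h) ≫ h' = f ≫ i → P.map h' p ∈ W.carrier T' i :=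
    fun hp e => mem_carrier_of_restrict_eq (hW _ _ _ (by rw [← e, Category.assoc]))
      (W.map_mem _ _ _ _ _ hp)
  let Z : QuotientSection P r R :=
    { carrier := fun T g => {p | ∀ (T' : AlgOver k) (h : T ⟶ T') (i : S ⟶ T'),
        g ≫ h = f ≫ i → P.map h p ∈ W.carrier T' i}
      map_mem := fun T T' g h p hp T'' h' i e => by
        rw [← Functor.map_comp_apply]
        exact hp T'' (h ≫ h') i (by rw [← e, Category.assoc])
      mem_of_cover := fun T T' g h p hh hp U h' i e => by
        obtain ⟨U', c, c', hc, e'⟩ := hh.baseChange h'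
        refine W.mem_of_cover U U' i c _ hc ?_
        rw [← Functor.map_comp_apply, e', Functor.map_comp_apply]
        exact hp U' c' (i ≫ c) (by
          rw [Category.assoc, ← e', ← Category.assoc, e, Category.assoc])
      mem_of_rel := fun T g p q hp h T' h' i e =>
        W.mem_of_rel T' i _ _ (hp T' h' i e) (hr.map h' h)
      locRel := fun T g p q hp hq => by
        obtain ⟨T', c, i, hc, e⟩ := hf.baseChange g
        exact .of_cover hc (W.locRel T' i _ _ (hp T' c i e) (hq T' c i e))
      exists_cover := by
        obtain ⟨T, h, hh, p, hp⟩ := W.exists_cover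
        exact ⟨T, f ≫ h, hf.comp hh, p, fun _ _ _ e => map_mem_of_comp_eq hp e⟩ }
  obtain ⟨T, h, hh, p, hp⟩ := W.exists_cover
  exact ⟨Z, eq_of_mem hh (p := p) (fun _ _ _ e => map_mem_of_comp_eq hp e) hp⟩

end QuotientSection

end QuotientSheaf

theorem isEquivRel_proportional (k : Type u) [CommRing k] :
    IsEquivRel (puncturedPlane k) (proportional k) where
  equiv R :=
    { refl := fun v => ⟨1, by simp⟩
      symm := by
        rintro v v' ⟨c, hc⟩
        exact ⟨c⁻¹, by simp [hc]⟩
      trans := by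
        rintro v v' v'' ⟨c, hc⟩ ⟨c', hc'⟩
        exact ⟨c' * c, by simp [hc, hc', mul_assoc]⟩ }
  map := by
    rintro R S f v v' ⟨c, hc⟩
    refine ⟨c.map f.right.hom, funext fun i => ?_⟩
    change f.right.hom (v'.1 i) = f.right.hom c * f.right.hom (v.1 i)
    rw [hc, map_mul]

section Actions

variable {k : Type u} [CommRing k] {R S : AlgOver k}

theorem planeAct_one (v : (puncturedPlane k).obj R) : planeAct 1 v = v :=
  Subtype.ext (by simp [planeAct])

theorem planeAct_mul (g h : GL (Fin 2) R.right) (v : (puncturedPlane k).obj R) :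
    planeAct (g * h) v = planeAct g (planeAct h v) :=
  Subtype.ext (Matrix.mulVec_mulVec v.1 g.1 h.1).symm

theorem lineAct_one (L : (projLine k).obj R) : lineAct 1 L = L := by
  refine QuotientSection.ext (funext fun S => funext fun f => Set.ext fun v => ?_)
  change planeAct _⁻¹ v ∈ L.carrier S f ↔ _
  rw [map_one, inv_one, planeAct_one]

theorem lineAct_mul (g h : GL (Fin 2) R.right) (L : (projLine k).obj R) :
    lineAct (g * h) L = lineAct g (lineAct h L) := by
  refine QuotientSection.ext (funext fun S => funext fun f => Set.ext fun v => ?_)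
  change planeAct _⁻¹ v ∈ L.carrier S f ↔ planeAct _⁻¹ (planeAct _⁻¹ v) ∈ L.carrier S f
  rw [map_mul, mul_inv_rev, planeAct_mul]

theorem lineAct_map (f : R ⟶ S) (g : GL (Fin 2) R.right) (L : (projLine k).obj R) :
    (projLine k).map f (lineAct g L) =
      lineAct (Matrix.GeneralLinearGroup.map f.right.hom g) ((projLine k).map f L) :=
  QuotientSection.ext (funext fun _ => funext fun _ => rfl)

theorem lineAct_eq_self_of_scalar {g : GL (Fin 2) R.right} {c : R.right}
    (hg : g.1 = Matrix.scalar (Fin 2) c) (L : (projLine k).obj R) : lineAct g L = L := by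
  obtain ⟨c, rfl⟩ : IsUnit c := by
    have hdet := (Matrix.isUnit_iff_isUnit_det _).mp g.isUnit
    rw [hg, Matrix.scalar_apply, Matrix.det_diagonal, Fin.prod_univ_two] at hdet
    exact isUnit_of_mul_isUnit_left hdet
  obtain ⟨S, f, hf, v, hv⟩ := L.exists_cover
  refine QuotientSection.eq_of_mem hf
    (p := planeAct (Matrix.GeneralLinearGroup.map f.right.hom g) v) ?_
    (L.mem_of_rel S f v _ hv ⟨c.map f.right.hom, funext fun i => ?_⟩)
  · change planeAct _⁻¹ (planeAct _ v) ∈ L.carrier S f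
    rwa [planeAct_act_inv]
  · change (g.1.map f.right.hom).mulVec v.1 i = f.right.hom c * v.1 i
    rw [hg]
    fin_cases i <;> simp [Matrix.mulVec, dotProduct]

/-- The conjugate `g A g⁻¹` of a matrix of determinant one by an invertible matrix. -/
def slConj {n : Type*} [Fintype n] [DecidableEq n] {R : Type*} [CommRing R] (g : GL n R)
    (A : Matrix.SpecialLinearGroup n R) : Matrix.SpecialLinearGroup n R :=
  ⟨g.1 * A.1 * (g⁻¹).1, (Matrix.det_units_conj g A.1).trans A.2⟩

theorem traces_slConj {R : Type u} [CommRing R] (g : GL (Fin 2) R)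
    (p : Matrix.SpecialLinearGroup (Fin 2) R × Matrix.SpecialLinearGroup (Fin 2) R) :
    traces (slConj g p.1, slConj g p.2) = traces p := by
  have conj_mul_conj : (g.1 * p.1.1 * (g⁻¹).1) * (g.1 * p.2.1 * (g⁻¹).1) =
      g.1 * (p.1.1 * p.2.1) * (g⁻¹).1 := by
    simp only [Matrix.mul_assoc, Units.inv_mul_cancel_left]
  exact Prod.ext (Matrix.trace_units_conj g _)
    (Prod.ext (Matrix.trace_units_conj g _)
      ((congrArg Matrix.trace conj_mul_conj).trans (Matrix.trace_units_conj g _)))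

/-- The action of `GL(2)` (through `PGL(2)`) on `𝒯` by simultaneous conjugation. -/
def torsorAct (g : GL (Fin 2) R.right) (T : (torsor k).obj R) : (torsor k).obj R :=
  ⟨(slConj g T.1.1, slConj g T.1.2), by rw [traces_slConj]; exact T.2⟩

theorem torsor_ext {T T' : (torsor k).obj R} (hA : T.1.1.1 = T'.1.1.1)
    (hB : T.1.2.1 = T'.1.2.1) : T = T' :=
  Subtype.ext (Prod.ext (Subtype.ext hA) (Subtype.ext hB))

theorem torsorAct_one (T : (torsor k).obj R) : torsorAct 1 T = T :=
  torsor_ext (by simp [torsorAct, slConj]) (by simp [torsorAct, slConj])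

theorem torsorAct_mul (g h : GL (Fin 2) R.right) (T : (torsor k).obj R) :
    torsorAct (g * h) T = torsorAct g (torsorAct h T) :=
  torsor_ext (by simp [torsorAct, slConj, mul_assoc]) (by simp [torsorAct, slConj, mul_assoc])

theorem torsorAct_map (f : R ⟶ S) (g : GL (Fin 2) R.right) (T : (torsor k).obj R) :
    (torsor k).map f (torsorAct g T) =
      torsorAct (Matrix.GeneralLinearGroup.map f.right.hom g) ((torsor k).map f T) := by
  have map_conj (M : Matrix (Fin 2) (Fin 2) R.right) : (g.1 * M * (g⁻¹).1).map f.right.hom =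
      (Matrix.GeneralLinearGroup.map f.right.hom g).1 * M.map f.right.hom *
        ((Matrix.GeneralLinearGroup.map f.right.hom g)⁻¹).1 := by
    rw [Matrix.map_mul, Matrix.map_mul, ← map_inv]
    rfl
  exact torsor_ext (map_conj _) (map_conj _)

theorem sameOrbit_iff {p q : (torsorProdLine k).obj R} :
    sameOrbit k R p q ↔ ∃ g : GL (Fin 2) R.right, q = (torsorAct g p.1, lineAct g p.2) :=
  exists_congr fun _ =>
    ⟨fun ⟨hA, hB, hL⟩ => Prod.ext (torsor_ext hA hB) hL, by rintro rfl; exact ⟨rfl, rfl, rfl⟩⟩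

theorem isEquivRel_sameOrbit (k : Type u) [CommRing k] :
    IsEquivRel (torsorProdLine k) (sameOrbit k) where
  equiv R :=
    { refl := fun p => sameOrbit_iff.mpr ⟨1, by rw [torsorAct_one, lineAct_one]; rfl⟩
      symm := by
        simp only [sameOrbit_iff]
        rintro p q ⟨g, rfl⟩
        refine ⟨g⁻¹, ?_⟩
        rw [← torsorAct_mul, ← lineAct_mul, inv_mul_cancel, torsorAct_one, lineAct_one]
        rfl
      trans := by
        simp only [sameOrbit_iff]
        rintro p q q' ⟨g, rfl⟩ ⟨h, rfl⟩
        exact ⟨h * g, by rw [torsorAct_mul, lineAct_mul]⟩ }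
  map := by
    simp only [sameOrbit_iff]
    rintro R S f p q ⟨g, rfl⟩
    exact ⟨Matrix.GeneralLinearGroup.map f.right.hom g,
      Prod.ext (torsorAct_map f g p.1) (lineAct_map f g p.2)⟩

end Actions

section SkolemNoether

variable {n : Type*} [Fintype n] [DecidableEq n] {R : Type*} [CommRing R]

/-- The matrix with columns `φ(E_{i i₀}) eⱼ`. It intertwines a homomorphism `φ` between matrix
rings with the standard representation; some choice of `j` makes it invertible over a field. -/
def conjugator {S : Type*} (φ : Matrix n n R → Matrix n n S) (i₀ j : n) : Matrix n n S :=
  .of fun a i => φ (.single i i₀ 1) a j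

theorem mul_conjugator_apply {S : Type*} [Semiring S] (φ : Matrix n n R →+* Matrix n n S)
    (i₀ j : n) (M : Matrix n n R) (a i : n) :
    (φ M * conjugator φ i₀ j) a i = φ (M * .single i i₀ 1) a j := by
  rw [map_mul]
  rfl

theorem mul_conjugator (φ : Matrix n n R →ₐ[R] Matrix n n R) (i₀ j : n) (M : Matrix n n R) :
    φ M * conjugator φ i₀ j = conjugator φ i₀ j * M := by
  ext a i
  have mul_single : M * .single i i₀ 1 = ∑ l, M l i • .single l i₀ (1 : R) := by
    ext b c
    by_cases h : i₀ = c <;> simp [Matrix.sum_apply, Matrix.single_apply, Matrix.mul_apply, h]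
  refine (mul_conjugator_apply (φ : Matrix n n R →+* Matrix n n R) i₀ j M a i).trans ?_
  change φ _ a j = _
  simp only [mul_single, map_sum, map_smul, Matrix.sum_apply, Matrix.smul_apply, smul_eq_mul,
    Matrix.mul_apply, conjugator, Matrix.of_apply, mul_comm]

theorem exists_det_conjugator_ne_zero {K : Type*} [Field K] (φ : Matrix n n R →+* Matrix n n K)
    (i₀ : n) : ∃ j, (conjugator φ i₀ j).det ≠ 0 := by
  by_contra! h
  have single_eq_zero : φ (.single i₀ i₀ 1) = 0 := by
    ext a j
    obtain ⟨w, hw, hPw⟩ := Matrix.exists_mulVec_eq_zero_iff.mpr (h j)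
    obtain ⟨l, hl⟩ := Function.ne_iff.mp hw
    have hEPw : (φ (.single i₀ l 1) * conjugator φ i₀ j).mulVec w a = 0 := by
      rw [← Matrix.mulVec_mulVec, hPw, Matrix.mulVec_zero, Pi.zero_apply]
    have entry (i : n) : (φ (.single i₀ l 1) * conjugator φ i₀ j) a i =
        if i = l then φ (.single i₀ i₀ 1) a j else 0 := by
      rw [mul_conjugator_apply]
      split_ifs with hi
      · rw [hi, Matrix.single_mul_single_same, one_mul]
      · rw [Matrix.single_mul_single_of_ne _ _ _ _ (Ne.symm hi), map_zero, Matrix.zero_apply]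
    simp only [Matrix.mulVec, dotProduct, entry, ite_mul, zero_mul, Finset.sum_ite_eq',
      Finset.mem_univ, if_true] at hEPw
    exact (mul_eq_zero.mp hEPw).resolve_right hl
  have one_eq_sum : (1 : Matrix n n R) =
      ∑ i, .single i i₀ 1 * .single i₀ i₀ 1 * .single i₀ i 1 := by
    simp only [Matrix.single_mul_single_same, mul_one]
    exact Matrix.sum_single_one.symm
  have : Nonempty n := ⟨i₀⟩
  refine one_ne_zero (α := Matrix n n K) ?_
  rw [← map_one φ, one_eq_sum]
  simp only [map_sum, map_mul, single_eq_zero, mul_zero, zero_mul, Finset.sum_const_zero]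

theorem span_det_conjugator (φ : Matrix n n R →+* Matrix n n R) (i₀ : n) :
    Ideal.span (Set.range fun j => (conjugator φ i₀ j).det) = ⊤ := by
  by_contra h
  obtain ⟨m, hm, hle⟩ := Ideal.exists_le_maximal _ h
  let _ := Ideal.Quotient.field m
  let π := Ideal.Quotient.mk m
  obtain ⟨j, hj⟩ := exists_det_conjugator_ne_zero (π.mapMatrix.comp φ) i₀
  have map_conjugator : conjugator (π.mapMatrix.comp φ) i₀ j = π.mapMatrix (conjugator φ i₀ j) :=
    rfl
  rw [map_conjugator, ← RingHom.map_det] at hj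
  exact hj (Ideal.Quotient.eq_zero_iff_mem.mpr (hle (Ideal.subset_span ⟨j, rfl⟩)))

theorem exists_gl_pi_map_eq_conj (φ : Matrix n n R →ₐ[R] Matrix n n R) (i₀ : n) {S : n → Type*}
    [∀ j, CommRing (S j)] [∀ j, Algebra R (S j)]
    (hS : ∀ j, IsUnit (algebraMap R (S j) (conjugator φ i₀ j).det)) :
    ∃ g : GL n (∀ j, S j), ∀ M : Matrix n n R,
      (φ M).map (algebraMap R (∀ j, S j)) =
        g.1 * M.map (algebraMap R (∀ j, S j)) * (g⁻¹).1 := by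
  let P : Matrix n n (∀ j, S j) := .of fun a i j => algebraMap R (S j) (conjugator φ i₀ j a i)
  have hP : IsUnit P.det := Pi.isUnit_iff.mpr fun j => by
    have : P.det j = algebraMap R (S j) (conjugator φ i₀ j).det := by
      rw [RingHom.map_det]
      exact RingHom.map_det (Pi.evalRingHom S j) P
    rw [this]
    exact hS j
  refine ⟨Matrix.GeneralLinearGroup.mk'' P hP, fun M => (Units.eq_mul_inv_iff_mul_eq _).mpr ?_⟩
  ext a i j
  have entry := congrArg (algebraMap R (S j)) (congrFun₂ (mul_conjugator φ i₀ j M) a i)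
  simp only [Matrix.mul_apply, map_sum, map_mul] at entry
  change (∑ b, (φ M).map (algebraMap R (∀ j, S j)) a b * P b i) j =
    (∑ b, P a b * M.map (algebraMap R (∀ j, S j)) b i) j
  rw [Finset.sum_apply, Finset.sum_apply]
  exact entry

end SkolemNoether

theorem exists_cover_map_eq_conj {k : Type u} [CommRing k] {R : AlgOver k} {n : Type} [Fintype n]
    [DecidableEq n] [Nonempty n] (φ : Matrix n n R.right →ₐ[R.right] Matrix n n R.right) :
    ∃ (S : AlgOver k) (f : R ⟶ S), IsEtaleCover f ∧ ∃ g : GL n S.right, ∀ M : Matrix n n R.right,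
      (φ M).map f.right.hom = g.1 * M.map f.right.hom * (g⁻¹).1 := by
  let i₀ : n := Classical.arbitrary n
  let d (j : n) : R.right := (conjugator φ i₀ j).det
  obtain ⟨g, hg⟩ := exists_gl_pi_map_eq_conj φ i₀ (S := fun j => Localization.Away (d j))
    fun j => IsLocalization.Away.algebraMap_isUnit (d j)
  have hd : Ideal.span (Set.range d) = ⊤ := span_det_conjugator φ.toRingHom i₀
  exact ⟨awayProd d, toAwayProd d, isEtaleCover_toAwayProd hd, g, hg⟩

section MatrixPairs

variable {R : Type*} [CommRing R]

theorem mul_self_fin_two (A : Matrix (Fin 2) (Fin 2) R) :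
    A * A = A.trace • A - A.det • (1 : Matrix (Fin 2) (Fin 2) R) := by
  ext i j
  fin_cases i <;> fin_cases j <;>
    simp [Matrix.mul_apply, Matrix.trace_fin_two, Matrix.det_fin_two] <;> ring

theorem mul_swap_fin_two (A B : Matrix (Fin 2) (Fin 2) R) :
    B * A = A.trace • B + B.trace • A + ((A * B).trace - A.trace * B.trace) • 1 - A * B := by
  ext i j
  fin_cases i <;> fin_cases j <;> simp [Matrix.mul_apply, Matrix.trace_fin_two] <;> ring

theorem det_commutator_fin_two (A B : Matrix (Fin 2) (Fin 2) R) :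
    (A * B - B * A).det = 4 * A.det * B.det + A.trace * B.trace * (A * B).trace
      - A.trace ^ 2 * B.det - B.trace ^ 2 * A.det - (A * B).trace ^ 2 := by
  simp only [Matrix.det_fin_two, Matrix.sub_apply, Matrix.mul_apply, Matrix.trace_fin_two,
    Fin.sum_univ_two]
  ring

theorem det_stdBasis_one_mul (A B : Matrix (Fin 2) (Fin 2) R) :
    ((Matrix.stdBasis R (Fin 2) (Fin 2)).reindex finProdFinEquiv).det ![1, A, B, A * B] =
      (A * B - B * A).det := by
  have toMatrix_eq :
      ((Matrix.stdBasis R (Fin 2) (Fin 2)).reindex finProdFinEquiv).toMatrix ![1, A, B, A * B] =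
        !![1, A 0 0, B 0 0, (A * B) 0 0; 0, A 0 1, B 0 1, (A * B) 0 1;
          0, A 1 0, B 1 0, (A * B) 1 0; 1, A 1 1, B 1 1, (A * B) 1 1] := by
    ext i j
    fin_cases i <;> fin_cases j <;> rfl
  rw [Module.Basis.det_apply, toMatrix_eq, Matrix.det_fin_two]
  simp [Matrix.det_succ_row_zero, Fin.sum_univ_succ, Fin.succAbove, Matrix.mul_apply]
  ring

variable {A B A' B' : Matrix (Fin 2) (Fin 2) R}

/-- The basis `1, A, B, AB` of the algebra of `2 × 2` matrices, for a pair of matrices with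
invertible commutator. -/
def pairBasis (h : IsUnit (A * B - B * A).det) :
    Module.Basis (Fin 4) R (Matrix (Fin 2) (Fin 2) R) :=
  have hb : LinearIndependent R ![1, A, B, A * B] ∧
      Submodule.span R (Set.range ![1, A, B, A * B]) = ⊤ :=
    ((Matrix.stdBasis R (Fin 2) (Fin 2)).reindex finProdFinEquiv).is_basis_iff_det.mpr
      (by rwa [det_stdBasis_one_mul])
  .mk hb.1 hb.2.ge

theorem coe_pairBasis (h : IsUnit (A * B - B * A).det) : ⇑(pairBasis h) = ![1, A, B, A * B] := by
  rw [pairBasis, Module.Basis.coe_mk]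

theorem pairBasis_linearMap_ext {M : Type*} [AddCommGroup M] [Module R M]
    (h : IsUnit (A * B - B * A).det) {φ ψ : Matrix (Fin 2) (Fin 2) R →ₗ[R] M} (h1 : φ 1 = ψ 1)
    (hA : φ A = ψ A) (hB : φ B = ψ B) (hAB : φ (A * B) = ψ (A * B)) : φ = ψ :=
  (pairBasis h).ext fun i => by
    rw [coe_pairBasis]
    fin_cases i
    exacts [h1, hA, hB, hAB]

theorem exists_scalar_of_commute_pair (h : IsUnit (A * B - B * A).det)
    {M : Matrix (Fin 2) (Fin 2) R} (hA : Commute M A) (hB : Commute M B) :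
    ∃ c, M = Matrix.scalar (Fin 2) c := by
  have mulLeft_eq : LinearMap.mulLeft R M = LinearMap.mulRight R M :=
    pairBasis_linearMap_ext h ((Commute.one_right M).eq) hA.eq hB.eq (hA.mul_right hB).eq
  have mem_center : M ∈ Set.center (Matrix (Fin 2) (Fin 2) R) :=
    Semigroup.mem_center_iff.mpr fun N => (LinearMap.congr_fun mulLeft_eq N).symm
  rw [Matrix.center_eq_range] at mem_center
  obtain ⟨c, rfl⟩ := mem_center
  exact ⟨c, rfl⟩

theorem map_mul_left_of_pair (h : IsUnit (A * B - B * A).det) (hdA : A'.det = A.det)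
    (hA : A'.trace = A.trace) {φ : Matrix (Fin 2) (Fin 2) R →ₗ[R] Matrix (Fin 2) (Fin 2) R}
    (φ_one : φ 1 = 1) (φ_left : φ A = A') (φ_right : φ B = B') (φ_mul : φ (A * B) = A' * B')
    (M : Matrix (Fin 2) (Fin 2) R) : φ (A * M) = A' * φ M := by
  refine LinearMap.congr_fun (f := φ ∘ₗ LinearMap.mulLeft R A)
    (g := LinearMap.mulLeft R A' ∘ₗ φ) (pairBasis_linearMap_ext h ?_ ?_ ?_ ?_) M
  all_goals simp only [LinearMap.comp_apply, LinearMap.mulLeft_apply]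
  · rw [mul_one, φ_left, φ_one, mul_one]
  · rw [φ_left, mul_self_fin_two A, mul_self_fin_two A']
    simp only [map_sub, map_smul, φ_left, φ_one, hA, hdA]
  · rw [φ_mul, φ_right]
  · rw [φ_mul, ← mul_assoc, ← mul_assoc, mul_self_fin_two A, mul_self_fin_two A']
    simp only [sub_mul, smul_mul_assoc, one_mul, map_sub, map_smul, φ_mul, φ_right, hA, hdA]

theorem exists_algHom_of_trace_eq (h : IsUnit (A * B - B * A).det) (hdA : A'.det = A.det)
    (hdB : B'.det = B.det) (hA : A'.trace = A.trace) (hB : B'.trace = B.trace)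
    (hAB : (A' * B').trace = (A * B).trace) :
    ∃ φ : Matrix (Fin 2) (Fin 2) R →ₐ[R] Matrix (Fin 2) (Fin 2) R, φ A = A' ∧ φ B = B' := by
  let φ := (pairBasis h).constr R ![1, A', B', A' * B']
  have φ_basis (i : Fin 4) : φ (![1, A, B, A * B] i) = ![1, A', B', A' * B'] i := by
    rw [← coe_pairBasis h]
    exact (pairBasis h).constr_basis R _ i
  have φ_one : φ 1 = 1 := φ_basis 0
  have φ_left : φ A = A' := φ_basis 1
  have φ_right : φ B = B' := φ_basis 2
  have φ_mul : φ (A * B) = A' * B' := φ_basis 3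
  have φ_swap : φ (B * A) = B' * A' := by
    rw [mul_swap_fin_two A B, mul_swap_fin_two A' B']
    simp only [map_sub, map_add, map_smul, φ_left, φ_right, φ_one, φ_mul, hA, hB, hAB]
  have h_swap : IsUnit (B * A - A * B).det := by
    rwa [← neg_sub (A * B), Matrix.det_neg, Fintype.card_fin, neg_one_sq, one_mul]
  have φ_mul_left := map_mul_left_of_pair h hdA hA φ_one φ_left φ_right φ_mul
  have φ_mul_right := map_mul_left_of_pair h_swap hdB hB φ_one φ_right φ_left φ_swap
  refine ⟨AlgHom.ofLinearMap φ φ_one fun M N => ?_, φ_left, φ_right⟩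
  refine LinearMap.congr_fun (f := φ ∘ₗ LinearMap.mulRight R N)
    (g := LinearMap.mulRight R (φ N) ∘ₗ φ) (pairBasis_linearMap_ext h ?_ ?_ ?_ ?_) M
  all_goals simp only [LinearMap.comp_apply, LinearMap.mulRight_apply, φ_mul_left, φ_mul_right,
    mul_assoc, one_mul, φ_one, φ_left, φ_right]

end MatrixPairs

section Fibres

variable {k : Type u} [CommRing k] {R S : AlgOver k}

theorem isUnit_det_commutator (T : (torsor k).obj R) :
    IsUnit (T.1.1.1 * T.1.2.1 - T.1.2.1 * T.1.1.1).det := by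
  have det_eq : (T.1.1.1 * T.1.2.1 - T.1.2.1 * T.1.1.1).det =
      -cayley (traces T.1).1 (traces T.1).2.1 (traces T.1).2.2 := by
    rw [det_commutator_fin_two, T.1.1.2, T.1.2.2]
    simp only [cayley, traces]
    ring
  rw [det_eq]
  exact T.2.neg

theorem exists_cover_torsorAct_eq {T T' : (torsor k).obj R}
    (h : torsorTraces T = torsorTraces T') :
    ∃ (S : AlgOver k) (f : R ⟶ S), IsEtaleCover f ∧ ∃ g : GL (Fin 2) S.right,
      (torsor k).map f T' = torsorAct g ((torsor k).map f T) := by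
  have traces_eq : traces T.1 = traces T'.1 := congrArg Subtype.val h
  obtain ⟨φ, hA, hB⟩ := exists_algHom_of_trace_eq (isUnit_det_commutator T)
    (T'.1.1.2.trans T.1.1.2.symm) (T'.1.2.2.trans T.1.2.2.symm)
    (congrArg Prod.fst traces_eq).symm (congrArg (·.2.1) traces_eq).symm
    (congrArg (·.2.2) traces_eq).symm
  obtain ⟨S, f, hf, g, hg⟩ := exists_cover_map_eq_conj φ
  refine ⟨S, f, hf, g, torsor_ext ?_ ?_⟩
  · exact (congrArg (·.map f.right.hom) hA).symm.trans (hg _)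
  · exact (congrArg (·.map f.right.hom) hB).symm.trans (hg _)

/-- The point of `X` that is the orbit of the point `(T, L)` of `𝒯 × ℙ¹`. -/
def fibrePoint (T : (torsor k).obj R) (L : (projLine k).obj R) : (conicBundle k).obj R :=
  .classOf (isEquivRel_sameOrbit k) ((T, L) : (torsorProdLine k).obj R)

theorem fibrePoint_map (f : R ⟶ S) (T : (torsor k).obj R) (L : (projLine k).obj R) :
    (conicBundle k).map f (fibrePoint T L) =
      fibrePoint ((torsor k).map f T) ((projLine k).map f L) :=
  QuotientSection.restrict_classOf _ f _

theorem bundleProj_fibrePoint (T : (torsor k).obj R) (L : (projLine k).obj R) :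
    bundleProj (fibrePoint T L) = torsorTraces T := by
  have liesOver := (bundleProj_eq_iff (fibrePoint T L) _).mp rfl R (𝟙 R) _
    (QuotientSection.mem_classOf (isEquivRel_sameOrbit k) _)
  rw [Functor.map_id_apply] at liesOver
  exact liesOver.symm

theorem fibrePoint_act (g : GL (Fin 2) R.right) (T : (torsor k).obj R) (L : (projLine k).obj R) :
    fibrePoint (torsorAct g T) (lineAct g L) = fibrePoint T L :=
  (QuotientSection.classOf_eq_classOf_iff _ _ _).mpr (.of_rel (sameOrbit_iff.mpr ⟨g, rfl⟩))

theorem lineAct_eq_self_of_torsorAct_eq_self {g : GL (Fin 2) R.right} {T : (torsor k).obj R}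
    (h : torsorAct g T = T) (L : (projLine k).obj R) : lineAct g L = L := by
  have commute_of_conj_eq {M : Matrix (Fin 2) (Fin 2) R.right} (hM : g.1 * M * (g⁻¹).1 = M) :
      Commute g.1 M := (Units.mul_inv_eq_iff_eq_mul g).mp hM
  obtain ⟨c, hc⟩ := exists_scalar_of_commute_pair (isUnit_det_commutator T)
    (commute_of_conj_eq (congrArg (·.1.1.1) h)) (commute_of_conj_eq (congrArg (·.1.2.1) h))
  exact lineAct_eq_self_of_scalar hc L

theorem fibrePoint_injective (T : (torsor k).obj R) : Function.Injective (fibrePoint T) := by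
  intro L L' h
  obtain ⟨S, f, hf, hrel⟩ := (QuotientSection.classOf_eq_classOf_iff _ _ _).mp h
  obtain ⟨g, hg⟩ := sameOrbit_iff.mp hrel
  have torsor_eq : (torsor k).map f T = torsorAct g ((torsor k).map f T) := congrArg Prod.fst hg
  have line_eq : (projLine k).map f L = lineAct g ((projLine k).map f L') := congrArg Prod.snd hg
  refine QuotientSection.restrict_injective hf ?_
  exact line_eq.trans (lineAct_eq_self_of_torsorAct_eq_self torsor_eq.symm _)

theorem exists_cover_fibrePoint_eq {T : (torsor k).obj R} {Z : (conicBundle k).obj R}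
    (hZ : bundleProj Z = torsorTraces T) :
    ∃ (S : AlgOver k) (f : R ⟶ S), IsEtaleCover f ∧ ∃ L,
      fibrePoint ((torsor k).map f T) L = (conicBundle k).map f Z := by
  obtain ⟨S, f, hf, ⟨T₁, L₁⟩, hmem⟩ := Z.exists_cover
  have map_Z : (conicBundle k).map f Z = fibrePoint T₁ L₁ :=
    QuotientSection.restrict_eq_classOf _ Z hmem
  have traces_eq : torsorTraces T₁ = torsorTraces ((torsor k).map f T) := by
    rw [← bundleProj_fibrePoint T₁ L₁, ← map_Z, bundleProj_map, hZ, torsorTraces_map]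
  obtain ⟨S', f', hf', g, hg⟩ := exists_cover_torsorAct_eq traces_eq
  refine ⟨S', f ≫ f', hf.comp hf', lineAct g ((projLine k).map f' L₁), ?_⟩
  rw [Functor.map_comp_apply, hg, fibrePoint_act, ← fibrePoint_map, ← map_Z,
    Functor.map_comp_apply]

theorem exists_fibrePoint_eq {T : (torsor k).obj R} {Z : (conicBundle k).obj R}
    (hZ : bundleProj Z = torsorTraces T) : ∃ L, fibrePoint T L = Z := by
  obtain ⟨S, f, hf, L', hL'⟩ := exists_cover_fibrePoint_eq hZ
  have fibrePoint_map_L' {S' : AlgOver k} (i : S ⟶ S') :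
      fibrePoint ((torsor k).map (f ≫ i) T) ((projLine k).map i L') =
        (conicBundle k).map (f ≫ i) Z := by
    rw [Functor.map_comp_apply, ← fibrePoint_map, hL', Functor.map_comp_apply]
  obtain ⟨L, hL⟩ := QuotientSection.exists_restrict_eq (isEquivRel_proportional k) hf L' <| by
    intro S' i j hij
    refine fibrePoint_injective ((torsor k).map (f ≫ i) T) ?_
    exact (fibrePoint_map_L' i).trans (hij ▸ (fibrePoint_map_L' j).symm)
  refine ⟨L, QuotientSection.restrict_injective hf ?_⟩
  exact (fibrePoint_map f T L).trans ((congrArg (fibrePoint _) hL).trans hL')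

end Fibres

section LineRestrict

-- Transport along the equality of structure morphisms `s = s'`, which holds propositionally only.
theorem mem_carrier_mk_iff {K : Type u} [CommRing K] {R : AlgOver K} (L : (projLine K).obj R)
    {A : CommRingCat.{u}} {s s' : CommRingCat.of K ⟶ A} (q : R.right ⟶ A) (w : R.hom ≫ q = s)
    (w' : R.hom ≫ q = s') (v : (puncturedPlane K).obj (Under.mk s)) :
    v ∈ L.carrier (Under.mk s) (Under.homMk q w) ↔
      (show (puncturedPlane K).obj (Under.mk s') from v) ∈
        L.carrier (Under.mk s') (Under.homMk q w') := by
  subst w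
  subst w'
  rfl

variable {k K : Type u} [CommRing k] [CommRing K] [Algebra k K]

/-- A `k`-algebra under a `K`-algebra `R`, as a `K`-algebra. -/
abbrev liftObj {R : AlgOver K} {S : AlgOver k} (f : (restrictBase k K).obj R ⟶ S) : AlgOver K :=
  Under.mk (R.hom ≫ (show R.right ⟶ S.right from f.right))

/-- A morphism of `k`-algebras that starts at a `K`-algebra, as a morphism of `K`-algebras. -/
abbrev liftHom {R : AlgOver K} {S : AlgOver k} (f : (restrictBase k K).obj R ⟶ S) :
    R ⟶ liftObj f :=
  Under.homMk (show R.right ⟶ S.right from f.right) rfl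

/-- A morphism of `k`-algebras under a `K`-algebra, as a morphism of `K`-algebras. -/
abbrev liftMap {R : AlgOver K} {S S' : AlgOver k} (f : (restrictBase k K).obj R ⟶ S)
    (g : S ⟶ S') : liftObj f ⟶ liftObj (f ≫ g) :=
  Under.homMk g.right (Category.assoc _ _ _)

/-- A point of `ℙ¹` over a `K`-algebra, for `ℙ¹` over `K`, as a point of `ℙ¹` over `k`. -/
def lineRestrict {R : AlgOver K} (L : (projLine K).obj R) :
    (projLine k).obj ((restrictBase k K).obj R) where
  carrier S f := {v | (show (puncturedPlane K).obj (liftObj f) from v) ∈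
    L.carrier (liftObj f) (liftHom f)}
  map_mem S S' f g v hv := L.map_mem _ _ (liftHom f) (liftMap f g) v hv
  mem_of_cover S S' f g v hg hv :=
    L.mem_of_cover _ _ (liftHom f) (liftMap f g) v hg hv
  mem_of_rel S f v v' hv h := L.mem_of_rel _ (liftHom f) v v' hv h
  locRel S f v v' hv hv' := by
    obtain ⟨T, g, hg, h⟩ := L.locRel _ (liftHom f) v v' hv hv'
    exact ⟨Under.mk (S.hom ≫ g.right), Under.homMk g.right rfl, hg, h⟩
  exists_cover := by
    obtain ⟨S, f, hf, v, hv⟩ := L.exists_cover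
    refine ⟨(restrictBase k K).obj S, (restrictBase k K).map f, hf, v, ?_⟩
    exact (mem_carrier_mk_iff L f.right (Under.w f) rfl v).mp hv

/-- A point of `ℙ¹` over a `K`-algebra, for `ℙ¹` over `k`, as a point of `ℙ¹` over `K`. -/
def lineExtend {R : AlgOver K} (L : (projLine k).obj ((restrictBase k K).obj R)) :
    (projLine K).obj R where
  carrier S f := {v | (show (puncturedPlane k).obj ((restrictBase k K).obj S) from v) ∈
    L.carrier ((restrictBase k K).obj S) ((restrictBase k K).map f)}
  map_mem S S' f g v hv := L.map_mem _ _ _ ((restrictBase k K).map g) v hv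
  mem_of_cover S S' f g v hg hv := L.mem_of_cover _ _ _ ((restrictBase k K).map g) v hg hv
  mem_of_rel S f v v' hv h := L.mem_of_rel ((restrictBase k K).obj S) _ v v' hv h
  locRel S f v v' hv hv' := by
    obtain ⟨T, g, hg, h⟩ := L.locRel ((restrictBase k K).obj S) _ v v' hv hv'
    exact ⟨liftObj g, liftHom g, hg, h⟩
  exists_cover := by
    obtain ⟨S, f, hf, v, hv⟩ := L.exists_cover
    refine ⟨liftObj f, liftHom f, hf, v, ?_⟩
    exact (mem_carrier_mk_iff L f.right (Under.w f) rfl v).mp hv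

variable (k) in
/-- The points of `ℙ¹` over a `K`-algebra do not depend on whether `ℙ¹` is taken over `K` or over
`k`. -/
def lineRestrictEquiv (R : AlgOver K) :
    (projLine K).obj R ≃ (projLine k).obj ((restrictBase k K).obj R) where
  toFun := lineRestrict
  invFun := lineExtend
  left_inv L := QuotientSection.ext <| funext fun _ => funext fun f => Set.ext fun v =>
    mem_carrier_mk_iff L f.right rfl (Under.w f) v
  right_inv L := QuotientSection.ext <| funext fun _ => funext fun f => Set.ext fun v =>
    mem_carrier_mk_iff L f.right rfl (Under.w f) v

theorem lineRestrict_map {R R' : AlgOver K} (h : R ⟶ R') (L : (projLine K).obj R) :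
    (projLine k).map ((restrictBase k K).map h) (lineRestrict L) =
      lineRestrict ((projLine K).map h L) := by
  refine QuotientSection.ext (funext fun S => funext fun f => Set.ext fun v => ?_)
  exact mem_carrier_mk_iff L (show R.right ⟶ S.right from h.right ≫ f.right) rfl
    (by rw [← Under.w h, Category.assoc]) v

theorem lineRestrict_lineAct {R : AlgOver K} (g : GL (Fin 2) R.right) (L : (projLine K).obj R) :
    lineRestrict (k := k) (lineAct g L) =
      lineAct (R := (restrictBase k K).obj R) g (lineRestrict L) :=
  rfl

end LineRestrict

section SpecialFibre

variable (k : Type u) {K : Type u} [CommRing k] [CommRing K] [Algebra k K] {s t u : K}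

/-- The `K`-point `(s, t, u)` of `V`, as a point over a given `K`-algebra `R`. -/
def pointOver (hF : IsUnit (cayley s t u)) (R : AlgOver K) :
    (traceSpace k).obj ((restrictBase k K).obj R) :=
  ⟨(R.hom.hom s, R.hom.hom t, R.hom.hom u), by
    have := hF.map R.hom.hom
    rwa [cayley_map] at this⟩

theorem pointOver_map (hF : IsUnit (cayley s t u)) {R R' : AlgOver K} (f : R ⟶ R') :
    (traceSpace k).map ((restrictBase k K).map f) (pointOver k hF R) = pointOver k hF R' := by
  have map_hom (x : K) : f.right.hom (R.hom.hom x) = R'.hom.hom x :=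
    congrArg (fun q : CommRingCat.of K ⟶ R'.right => q.hom x) (Under.w f)
  exact Subtype.ext (Prod.ext (map_hom _) (Prod.ext (map_hom _) (map_hom _)))

/-- The fibre of `X ⟶ V` over the `K`-point `(s, t, u)`. For the generic point, this is
`genericFibre`. -/
def fibre (hF : IsUnit (cayley s t u)) : AlgOver K ⥤ Type (u + 1) where
  obj R := {Z : (conicBundle k).obj ((restrictBase k K).obj R) // bundleProj Z = pointOver k hF R}
  map f := ↾fun Z => ⟨(conicBundle k).map ((restrictBase k K).map f) Z.1, by
    rw [bundleProj_map, Z.2, pointOver_map]⟩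
  map_id R := ConcreteCategory.hom_ext _ _ fun Z => Subtype.ext (by
    change (conicBundle k).map ((restrictBase k K).map (𝟙 R)) Z.1 = Z.1
    rw [CategoryTheory.Functor.map_id, CategoryTheory.Functor.map_id]; rfl)
  map_comp f g := ConcreteCategory.hom_ext _ _ fun Z => Subtype.ext (by
    change (conicBundle k).map ((restrictBase k K).map (f ≫ g)) Z.1 = _
    rw [Functor.map_comp, Functor.map_comp]; rfl)

end SpecialFibre

section Trivialization

/-- The structure morphism of a `C`-algebra `R`, as a morphism from the initial `C`-algebra. -/
def fromInitial {C : Type u} [CommRing C] (R : AlgOver C) :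
    Under.mk (𝟙 (CommRingCat.of C)) ⟶ R :=
  Under.homMk R.hom (Category.id_comp _)

theorem fromInitial_comp {C : Type u} [CommRing C] {R R' : AlgOver C} (f : R ⟶ R') :
    fromInitial R ≫ f = fromInitial R' :=
  Under.UnderMorphism.ext (Under.w f)

variable {k K L : Type u} [CommRing k] [CommRing K] [Algebra k K] [CommRing L] [Algebra K L]

/-- The points of the torsor `𝒯` with values in `L`, for a tower `k → K → L`. -/
abbrev TorsorPoint (k K L : Type u) [CommRing k] [CommRing K] [Algebra k K] [CommRing L]
    [Algebra K L] : Type u :=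
  (torsor k).obj ((restrictBase k K).obj ((restrictBase K L).obj (Under.mk (𝟙 (CommRingCat.of L)))))

/-- The base change of an `L`-point of `𝒯` to an `L`-algebra. -/
def TorsorPoint.baseChange (T : TorsorPoint k K L) (R : AlgOver L) :
    (torsor k).obj ((restrictBase k K).obj ((restrictBase K L).obj R)) :=
  (torsor k).map ((restrictBase k K).map ((restrictBase K L).map (fromInitial R))) T

theorem TorsorPoint.baseChange_map (T : TorsorPoint k K L) {R R' : AlgOver L} (f : R ⟶ R') :
    (torsor k).map ((restrictBase k K).map ((restrictBase K L).map f)) (T.baseChange R) =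
      T.baseChange R' := by
  rw [baseChange, ← Functor.map_comp_apply, ← Functor.map_comp, ← Functor.map_comp,
    fromInitial_comp]
  rfl

theorem TorsorPoint.baseChange_initial (T : TorsorPoint k K L) :
    T.baseChange (Under.mk (𝟙 (CommRingCat.of L))) = T := by
  have : fromInitial (Under.mk (𝟙 (CommRingCat.of L))) = 𝟙 _ := rfl
  rw [baseChange, this, CategoryTheory.Functor.map_id, CategoryTheory.Functor.map_id,
    Functor.map_id_apply]

variable {s t u : K} (hF : IsUnit (cayley s t u)) (T : TorsorPoint k K L)
  (hT : torsorTraces T = pointOver k hF _)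

include hT

theorem TorsorPoint.torsorTraces_baseChange (R : AlgOver L) :
    torsorTraces (T.baseChange R) = pointOver k hF ((restrictBase K L).obj R) := by
  rw [baseChange, torsorTraces_map, hT]
  exact pointOver_map k hF ((restrictBase K L).map (fromInitial R))

/-- A point of `𝒯` over `(s, t, u)` trivializes the fibre of `X ⟶ V` over `(s, t, u)`. -/
def trivializationEquiv (R : AlgOver L) :
    (restrictBase K L ⋙ projLine K).obj R ≃ (restrictBase K L ⋙ fibre k hF).obj R :=
  (lineRestrictEquiv k _).trans <| .ofBijective
    (fun L' => ⟨fibrePoint (T.baseChange R) L', by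
      rw [bundleProj_fibrePoint, T.torsorTraces_baseChange hF hT]⟩)
    ⟨fun _ _ h => fibrePoint_injective _ (congrArg Subtype.val h), fun Z =>
      (exists_fibrePoint_eq (Z.2.trans (T.torsorTraces_baseChange hF hT R).symm)).imp
        fun _ h => Subtype.ext h⟩

/-- The isomorphism from `ℙ¹` to the fibre of `X ⟶ V` over `(s, t, u)`, over an algebra `L`, given
by an `L`-point of `𝒯` over `(s, t, u)`. -/
def trivialization : restrictBase K L ⋙ projLine K ≅ restrictBase K L ⋙ fibre k hF :=
  NatIso.ofComponents (fun R => (trivializationEquiv hF T hT R).toIso) fun {R R'} f => by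
    refine ConcreteCategory.hom_ext _ _ fun L' => Subtype.ext ?_
    change fibrePoint (T.baseChange R')
        (lineRestrict ((projLine K).map ((restrictBase K L).map f) L')) =
      (conicBundle k).map ((restrictBase k K).map ((restrictBase K L).map f))
        (fibrePoint (T.baseChange R) (lineRestrict L'))
    rw [fibrePoint_map, T.baseChange_map, ← lineRestrict_map]

end Trivialization

section BrauerClass

variable {k K : Type u} [CommRing k] [Field K] [Algebra k K] {s t u : K}

theorem hasBrauerClass_fibre (hF : IsUnit (cayley s t u))
    (T : TorsorPoint k K (AlgebraicClosure K)) (hT : torsorTraces T = pointOver k hF _)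
    {g : Gal(AlgebraicClosure K/K) → Matrix.SpecialLinearGroup (Fin 2) (AlgebraicClosure K)}
    (g_locallyConstant : IsLocallyConstant g)
    (g_act : ∀ σ, torsorAct (R := (restrictBase k K).obj (closurePt K))
      (Matrix.SpecialLinearGroup.toGL (g σ))
      ((torsor k).map ((restrictBase k K).map (galHom σ)) T) = T)
    (a : twoCocycles K)
    (g_mul : ∀ σ τ, (g σ * Matrix.SpecialLinearGroup.map
        (σ : AlgebraicClosure K →+* AlgebraicClosure K) (g τ)).1 =
      ((a.1 (σ, τ) : (AlgebraicClosure K)ˣ) : AlgebraicClosure K) • (g (σ * τ)).1) :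
    HasBrauerClass (fibre k hF) (QuotientGroup.mk a) := by
  refine ⟨trivialization hF T hT, g, a, g_locallyConstant, fun σ L => Subtype.ext ?_, g_mul, rfl⟩
  change (conicBundle k).map ((restrictBase k K).map (galHom σ))
      (fibrePoint (T.baseChange _) (lineRestrict L)) =
    fibrePoint (T.baseChange _) (lineRestrict (lineAct (R := closurePt K) _ _))
  rw [T.baseChange_initial, fibrePoint_map, lineRestrict_lineAct, ← lineRestrict_map]
  conv_rhs => rw [← g_act σ]
  exact (fibrePoint_act _ _ _).symm

end BrauerClass

section NormalPair

variable {L : Type u} [Field L]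

/-- The diagonal matrix of determinant `1` with trace `t` and difference of eigenvalues `α`, where
`α ^ 2 = t ^ 2 - 4`. -/
def normalRight (t α : L) : Matrix (Fin 2) (Fin 2) L := !![(t + α) / 2, 0; 0, (t - α) / 2]

/-- The matrix `A` of determinant `1` and trace `s` with upper right entry `1` such that
`A * normalRight t α` has trace `u`, where `α ^ 2 = t ^ 2 - 4`. -/
def normalLeft (s t u α : L) : Matrix (Fin 2) (Fin 2) L :=
  !![(u - s * (t - α) / 2) / α, 1; -cayley s t u / α ^ 2, (s * (t + α) / 2 - u) / α]

theorem normalRight_map {L' : Type u} [Field L'] (f : L →+* L') (t α : L) :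
    (normalRight t α).map f = normalRight (f t) (f α) := by
  ext i j
  fin_cases i <;> fin_cases j <;> simp [normalRight, map_ofNat f 2]

theorem normalLeft_map {L' : Type u} [Field L'] (f : L →+* L') (s t u α : L) :
    (normalLeft s t u α).map f = normalLeft (f s) (f t) (f u) (f α) := by
  ext i j
  fin_cases i <;> fin_cases j <;> simp [normalLeft, cayley_map, map_ofNat f 2]

variable [NeZero (2 : L)] {s t u α : L}

theorem trace_normalRight : (normalRight t α).trace = t := by
  rw [normalRight, Matrix.trace_fin_two_of]
  field_simp
  ring

theorem det_normalRight (hα : α ^ 2 = t ^ 2 - 4) : (normalRight t α).det = 1 := by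
  have two_ne_zero' : (2 : L) ≠ 0 := two_ne_zero
  rw [normalRight, Matrix.det_fin_two_of]
  field_simp
  linear_combination -hα

theorem trace_normalLeft (hα₀ : α ≠ 0) : (normalLeft s t u α).trace = s := by
  rw [normalLeft, Matrix.trace_fin_two_of]
  field_simp
  ring

theorem det_normalLeft (hα₀ : α ≠ 0) (hα : α ^ 2 = t ^ 2 - 4) :
    (normalLeft s t u α).det = 1 := by
  rw [normalLeft, Matrix.det_fin_two_of, cayley]
  field_simp
  linear_combination (s ^ 2 - 4) * hα

theorem trace_normalLeft_mul_normalRight (hα₀ : α ≠ 0) :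
    (normalLeft s t u α * normalRight t α).trace = u := by
  rw [normalLeft, normalRight, Matrix.mul_fin_two, Matrix.trace_fin_two_of]
  field_simp
  ring

/-- The pair `(normalLeft, normalRight)` in `SL(2)`, with traces `(s, t, u)`. -/
def normalPair (s t u : L) (hα₀ : α ≠ 0) (hα : α ^ 2 = t ^ 2 - 4) :
    Matrix.SpecialLinearGroup (Fin 2) L × Matrix.SpecialLinearGroup (Fin 2) L :=
  (⟨normalLeft s t u α, det_normalLeft hα₀ hα⟩, ⟨normalRight t α, det_normalRight hα⟩)

theorem traces_normalPair (hα₀ : α ≠ 0) (hα : α ^ 2 = t ^ 2 - 4) :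
    traces (normalPair s t u hα₀ hα) = (s, t, u) :=
  Prod.ext (trace_normalLeft hα₀)
    (Prod.ext trace_normalRight (trace_normalLeft_mul_normalRight hα₀))

end NormalPair

section WeylElement

/-- The representative `!![0, γ⁻¹; -γ, 0]` in `SL(2)` of the nontrivial element of the Weyl
group of the diagonal torus. -/
def weylElement {R : Type*} [CommRing R] (γ : Rˣ) : Matrix.SpecialLinearGroup (Fin 2) R :=
  ⟨!![0, (γ⁻¹ : Rˣ); -γ, 0], by simp [Matrix.det_fin_two_of]⟩

theorem weylElement_map {R R' : Type*} [CommRing R] [CommRing R'] (f : R →+* R') (γ : Rˣ) :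
    Matrix.SpecialLinearGroup.map f (weylElement γ) = weylElement (Units.map f γ) := by
  refine Subtype.ext ?_
  change Matrix.map !![0, ((γ⁻¹ : Rˣ) : R); -γ, 0] f = _
  ext i j
  fin_cases i <;> fin_cases j <;> simp [weylElement]

theorem weylElement_mul_self {R : Type*} [CommRing R] (γ : Rˣ) :
    (weylElement γ).1 * (weylElement γ).1 = -1 := by
  rw [weylElement, Matrix.mul_fin_two]
  simp [Matrix.one_fin_two]

theorem weylElement_mul_of_mul_self_eq_one {R : Type*} [CommRing R] {ε : Rˣ} (hε : ε * ε = 1)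
    (γ : Rˣ) : (weylElement (ε * γ)).1 = (ε : R) • (weylElement γ).1 := by
  have inv_eq : ε⁻¹ = ε := inv_eq_of_mul_eq_one_left hε
  ext i j
  fin_cases i <;> fin_cases j <;> simp [weylElement, inv_eq, mul_comm]

variable {L : Type u} [Field L] {s t u : L}

theorem weylElement_mul_normalRight (t α : L) (γ : Lˣ) :
    (weylElement γ).1 * normalRight t (-α) = normalRight t α * (weylElement γ).1 := by
  simp only [weylElement, normalRight, Matrix.mul_fin_two, EmbeddingLike.apply_eq_iff_eq,
    Matrix.vecCons_inj]
  refine ⟨⟨?_, ?_, trivial⟩, ⟨?_, ?_, trivial⟩, trivial⟩ <;> ring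

theorem weylElement_mul_normalLeft {α : L} {γ : Lˣ}
    (hγ : (γ : L) ^ 2 * α ^ 2 = cayley s t u) (hα₀ : α ≠ 0) :
    (weylElement γ).1 * normalLeft s t u (-α) = normalLeft s t u α * (weylElement γ).1 := by
  have lower_left : -cayley s t u / α ^ 2 = -(γ : L) ^ 2 := by
    rw [← hγ]
    field_simp
  simp only [weylElement, normalLeft, neg_sq, lower_left, Matrix.mul_fin_two,
    EmbeddingLike.apply_eq_iff_eq, Matrix.vecCons_inj, Units.val_inv_eq_inv_val]
  refine ⟨⟨?_, ?_, trivial⟩, ⟨?_, ?_, trivial⟩, trivial⟩ <;> field_simp <;> ring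

end WeylElement

section KummerLift

variable {K : Type u} [Field K]

theorem map_sqrtUnit (a : Kˣ) (σ : Gal(AlgebraicClosure K/K)) :
    Units.map (σ : AlgebraicClosure K →* AlgebraicClosure K) (sqrtUnit a) =
      kummer a σ * sqrtUnit a :=
  (inv_mul_cancel_right _ _).symm

theorem muTwo_smul_map (σ : Gal(AlgebraicClosure K/K)) (x : MuTwo K)
    (M : Matrix (Fin 2) (Fin 2) (AlgebraicClosure K)) : (x • M).map σ = x • M.map σ := by
  ext i j
  conv_rhs => rw [← galMu_apply σ x]
  exact map_mul σ _ _

theorem muTwo_smul_eq_neg {x : MuTwo K} (hx : x ≠ 1)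
    (M : Matrix (Fin 2) (Fin 2) (AlgebraicClosure K)) : x • M = -M := by
  change ((x : (AlgebraicClosure K)ˣ) : AlgebraicClosure K) • M = -M
  rw [(muTwo_eq_or x).resolve_left hx, neg_one_smul]

theorem muTwo_mul_eq_one {x y : MuTwo K} (hx : x ≠ 1) (hy : y ≠ 1) : x * y = 1 := by
  refine Subtype.ext (Units.ext ?_)
  change ((x : (AlgebraicClosure K)ˣ) : AlgebraicClosure K) * (y : (AlgebraicClosure K)ˣ) = 1
  rw [(muTwo_eq_or x).resolve_left hx, (muTwo_eq_or y).resolve_left hy, neg_mul_neg, one_mul]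

/-- The scale `√b / √a`, which makes the Weyl element conjugate the two normal pairs attached to
`√a` and `-√a`. -/
def weylScale (a b : Kˣ) : (AlgebraicClosure K)ˣ := sqrtUnit b / sqrtUnit a

theorem coe_weylElement_muTwo_mul (x : MuTwo K) (γ : (AlgebraicClosure K)ˣ) :
    (weylElement ((x : (AlgebraicClosure K)ˣ) * γ)).1 = x • (weylElement γ).1 :=
  weylElement_mul_of_mul_self_eq_one (congrArg Subtype.val (muTwo_mul_self x)) γ

theorem map_weylScale (a b : Kˣ) (σ : Gal(AlgebraicClosure K/K)) :
    Units.map (σ : AlgebraicClosure K →* AlgebraicClosure K) (weylScale a b) =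
      (kummer a σ * kummer b σ : MuTwo K) * weylScale a b := by
  have inv_kummer : (kummer a σ)⁻¹ = kummer a σ := inv_eq_of_mul_eq_one_left (muTwo_mul_self _)
  rw [weylScale, map_div, map_sqrtUnit, map_sqrtUnit, mul_div_mul_comm, ← Subgroup.coe_div,
    div_eq_mul_inv (kummer b σ), inv_kummer, mul_comm (kummer b σ)]

theorem weylElement_weylScale_map (a b : Kˣ) (σ : Gal(AlgebraicClosure K/K)) :
    (weylElement (weylScale a b)).1.map σ =
      (kummer a σ * kummer b σ) • (weylElement (weylScale a b)).1 := by
  rw [← coe_weylElement_muTwo_mul, ← map_weylScale]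
  exact congrArg Subtype.val
    (weylElement_map (σ : AlgebraicClosure K →+* AlgebraicClosure K) (weylScale a b))

open Classical in
/-- A lift to `SL(2)` of the `PGL(2)`-valued cocycle which is trivial where `√a` is fixed and the
Weyl element of scale `σ(√b) / √a` where `σ` changes the sign of `√a`. -/
def weylLift (a b : Kˣ) (σ : Gal(AlgebraicClosure K/K)) :
    Matrix.SpecialLinearGroup (Fin 2) (AlgebraicClosure K) :=
  if kummer a σ = 1 then 1 else weylElement ((kummer b σ : (AlgebraicClosure K)ˣ) * weylScale a b)

theorem weylLift_of_eq_one {a : Kˣ} (b : Kˣ) {σ : Gal(AlgebraicClosure K/K)}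
    (h : kummer a σ = 1) : weylLift a b σ = 1 :=
  if_pos h

theorem coe_weylLift_of_ne_one {a : Kˣ} (b : Kˣ) {σ : Gal(AlgebraicClosure K/K)}
    (h : kummer a σ ≠ 1) :
    (weylLift a b σ).1 = kummer b σ • (weylElement (weylScale a b)).1 := by
  rw [weylLift, if_neg h, coe_weylElement_muTwo_mul]

theorem weylLift_isLocallyConstant (a b : Kˣ) : IsLocallyConstant (weylLift a b) := by
  classical
  exact (kummer_isLocallyConstant a).comp₂ (kummer_isLocallyConstant b)
    fun x y => if x = 1 then 1 else weylElement ((y : (AlgebraicClosure K)ˣ) * weylScale a b)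

theorem weylLift_mul (a b : Kˣ) (σ τ : Gal(AlgebraicClosure K/K)) :
    (weylLift a b σ).1 * (weylLift a b τ).1.map σ =
      muPairing (kummer a σ) (galMu σ (kummer b τ)) • (weylLift a b (σ * τ)).1 := by
  rw [galMu_apply, muPairing]
  by_cases hσ : kummer a σ = 1 <;> by_cases hτ : kummer a τ = 1
  · have hστ : kummer a (σ * τ) = 1 := by rw [kummer_mul, hσ, hτ, one_mul]
    simp [weylLift_of_eq_one, hσ, hτ, hστ]
  · have hστ : kummer a (σ * τ) ≠ 1 := by rwa [kummer_mul, hσ, one_mul]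
    rw [if_pos hσ, weylLift_of_eq_one b hσ, coe_weylLift_of_ne_one b hτ,
      coe_weylLift_of_ne_one b hστ, muTwo_smul_map, weylElement_weylScale_map, hσ, smul_smul,
      kummer_mul b, one_mul, one_smul, mul_comm (kummer b τ)]
    exact one_mul _
  · have hστ : kummer a (σ * τ) ≠ 1 := by rwa [kummer_mul, hτ, mul_one]
    rw [if_neg hσ, weylLift_of_eq_one b hτ, coe_weylLift_of_ne_one b hσ,
      coe_weylLift_of_ne_one b hστ, smul_smul, kummer_mul b, mul_left_comm, muTwo_mul_self,
      mul_one, Matrix.SpecialLinearGroup.coe_one, Matrix.map_one σ (map_zero σ) (map_one σ),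
      mul_one]
  · have hστ : kummer a (σ * τ) = 1 := by rw [kummer_mul, muTwo_mul_eq_one hσ hτ]
    rw [if_neg hσ, weylLift_of_eq_one b hστ, coe_weylLift_of_ne_one b hσ,
      coe_weylLift_of_ne_one b hτ, muTwo_smul_map, weylElement_weylScale_map, smul_smul,
      smul_mul_smul_comm, weylElement_mul_self]
    have signs_mul : kummer b σ * (kummer b τ * (kummer a σ * kummer b σ)) =
        kummer b τ * kummer a σ := by
      rw [mul_left_comm, mul_left_comm (kummer b σ), muTwo_mul_self, mul_one]
    rw [signs_mul, mul_smul, muTwo_smul_eq_neg hσ, neg_neg, Matrix.SpecialLinearGroup.coe_one]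

end KummerLift

section NormalPoint

theorem torsorAct_eq_of_mul_eq {k : Type u} [CommRing k] {R : AlgOver k} {g : GL (Fin 2) R.right}
    {T T' : (torsor k).obj R} (hA : g.1 * T.1.1.1 = T'.1.1.1 * g.1)
    (hB : g.1 * T.1.2.1 = T'.1.2.1 * g.1) : torsorAct g T = T' :=
  torsor_ext ((Units.mul_inv_eq_iff_eq_mul g).mpr hA) ((Units.mul_inv_eq_iff_eq_mul g).mpr hB)

variable {K : Type u} [Field K] {a b : Kˣ}

theorem weylLift_mul_map {N : AlgebraicClosure K → Matrix (Fin 2) (Fin 2) (AlgebraicClosure K)}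
    {σ : Gal(AlgebraicClosure K/K)} (map_N : (N (sqrtUnit a)).map σ = N (σ (sqrtUnit a)))
    (weyl_mul_N : (weylElement (weylScale a b)).1 * N (-sqrtUnit a) =
      N (sqrtUnit a) * (weylElement (weylScale a b)).1) :
    (weylLift a b σ).1 * (N (sqrtUnit a)).map σ = N (sqrtUnit a) * (weylLift a b σ).1 := by
  have map_sqrt : σ (sqrtUnit a) = ((kummer a σ • sqrtUnit a : (AlgebraicClosure K)ˣ) :
      AlgebraicClosure K) := congrArg Units.val (map_sqrtUnit a σ)
  rw [map_N, map_sqrt]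
  by_cases hσ : kummer a σ = 1
  · rw [weylLift_of_eq_one b hσ, hσ, one_smul, Matrix.SpecialLinearGroup.coe_one, one_mul, mul_one]
  · have neg_sqrt : ((kummer a σ • sqrtUnit a : (AlgebraicClosure K)ˣ) : AlgebraicClosure K) =
        -sqrtUnit a := by
      change ((kummer a σ : (AlgebraicClosure K)ˣ) : AlgebraicClosure K) * sqrtUnit a = _
      rw [(muTwo_eq_or _).resolve_left hσ, neg_one_mul]
    rw [coe_weylLift_of_ne_one b hσ, neg_sqrt, smul_mul_assoc, weyl_mul_N, mul_smul_comm]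

variable {s t u : K}

theorem weylScale_sq_mul (hb : (b : K) = cayley s t u) :
    (weylScale a b : AlgebraicClosure K) ^ 2 * (sqrtUnit a : AlgebraicClosure K) ^ 2 =
      cayley (algebraMap K _ s) (algebraMap K _ t) (algebraMap K _ u) := by
  rw [weylScale, ← mul_pow, ← Units.val_mul, div_mul_cancel, sqrtUnit_sq, hb, cayley_map]

theorem sqrtUnit_sq_eq_sq_sub_four (ha : (a : K) = t ^ 2 - 4) :
    (sqrtUnit a : AlgebraicClosure K) ^ 2 = algebraMap K _ t ^ 2 - 4 := by
  rw [sqrtUnit_sq, ha, map_sub, map_pow, map_ofNat]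

variable [NeZero (2 : K)]

instance algebraicClosure_neZero_two : NeZero (2 : AlgebraicClosure K) :=
  ⟨by
    rw [← map_ofNat (algebraMap K (AlgebraicClosure K)) 2]
    exact (map_ne_zero _).mpr two_ne_zero⟩

/-- The normal pair over the algebraic closure with traces `(s, t, u)`, defined by the chosen square
root of `a = t ^ 2 - 4`. -/
def closureNormalPair (s u : K) (ha : (a : K) = t ^ 2 - 4) :
    Matrix.SpecialLinearGroup (Fin 2) (AlgebraicClosure K) ×
      Matrix.SpecialLinearGroup (Fin 2) (AlgebraicClosure K) :=
  normalPair (algebraMap K _ s) (algebraMap K _ t) (algebraMap K _ u) (sqrtUnit a).ne_zero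
    (sqrtUnit_sq_eq_sq_sub_four ha)

theorem isUnit_cayley_traces_closureNormalPair (ha : (a : K) = t ^ 2 - 4)
    (hF : IsUnit (cayley s t u)) :
    IsUnit (cayley (traces (closureNormalPair s u ha)).1 (traces (closureNormalPair s u ha)).2.1
      (traces (closureNormalPair s u ha)).2.2) := by
  rw [closureNormalPair, traces_normalPair, ← cayley_map]
  exact hF.map (algebraMap K _)

variable (k : Type u) [CommRing k] [Algebra k K]

/-- `closureNormalPair` as a point of `𝒯`. -/
def normalPoint (ha : (a : K) = t ^ 2 - 4) (hF : IsUnit (cayley s t u)) :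
    TorsorPoint k K (AlgebraicClosure K) :=
  ⟨closureNormalPair s u ha, isUnit_cayley_traces_closureNormalPair ha hF⟩

theorem torsorTraces_normalPoint (ha : (a : K) = t ^ 2 - 4) (hF : IsUnit (cayley s t u)) :
    torsorTraces (normalPoint k ha hF) = pointOver k hF _ :=
  Subtype.ext (traces_normalPair (sqrtUnit a).ne_zero (sqrtUnit_sq_eq_sq_sub_four ha))

theorem torsorAct_weylLift_map_normalPoint (ha : (a : K) = t ^ 2 - 4)
    (hF : IsUnit (cayley s t u)) (hb : (b : K) = cayley s t u) (σ : Gal(AlgebraicClosure K/K)) :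
    torsorAct (R := (restrictBase k K).obj (closurePt K))
      (Matrix.SpecialLinearGroup.toGL (weylLift a b σ))
      ((torsor k).map ((restrictBase k K).map (galHom σ)) (normalPoint k ha hF)) =
        normalPoint k ha hF := by
  have map_base (x : K) : (σ : AlgebraicClosure K →+* AlgebraicClosure K) (algebraMap K _ x) =
      algebraMap K _ x := σ.commutes x
  refine torsorAct_eq_of_mul_eq
    (weylLift_mul_map (N := normalLeft (algebraMap K _ s) (algebraMap K _ t) (algebraMap K _ u))
      ?_ (weylElement_mul_normalLeft (weylScale_sq_mul hb) (sqrtUnit a).ne_zero))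
    (weylLift_mul_map (N := normalRight (algebraMap K _ t)) ?_ (weylElement_mul_normalRight _ _ _))
  · have := normalLeft_map (σ : AlgebraicClosure K →+* AlgebraicClosure K) (algebraMap K _ s)
      (algebraMap K _ t) (algebraMap K _ u) (sqrtUnit a)
    rwa [map_base, map_base, map_base] at this
  · have := normalRight_map (σ : AlgebraicClosure K →+* AlgebraicClosure K) (algebraMap K _ t)
      (sqrtUnit a)
    rwa [map_base] at this

end NormalPoint

end

end TraceConic

theorem mainTheorem6_general (k K : Type u) [CommRing k] [Field K] [Algebra k K] [NeZero (2 : K)]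
    {s t u : K} (ht : t ^ 2 - 4 ≠ 0) (hF : TraceConic.cayley s t u ≠ 0) :
    TraceConic.HasBrauerClass (TraceConic.fibre k hF.isUnit)
      (TraceConic.symbol (Units.mk0 _ ht) (Units.mk0 _ hF)) :=
  TraceConic.hasBrauerClass_fibre hF.isUnit (TraceConic.normalPoint k rfl hF.isUnit)
    (TraceConic.torsorTraces_normalPoint k rfl hF.isUnit)
    (TraceConic.weylLift_isLocallyConstant _ _)
    (TraceConic.torsorAct_weylLift_map_normalPoint k rfl hF.isUnit rfl) _
    (TraceConic.weylLift_mul _ _)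

theorem mainTheorem6 (k : Type u) [Field k] [CharZero k] :
    TraceConic.HasBrauerClass (TraceConic.genericFibre k)
      (TraceConic.symbol
        (Units.mk0 (TraceConic.coord k 1 ^ 2 - 4) (TraceConic.coord_sq_sub_four_ne_zero k))
        (Units.mk0 (TraceConic.cayley (TraceConic.coord k 0) (TraceConic.coord k 1)
          (TraceConic.coord k 2)) (TraceConic.cayley_coord_ne_zero k))) :=
  mainTheorem6_general k (TraceConic.FunField k) (TraceConic.coord_sq_sub_four_ne_zero k)
    (TraceConic.cayley_coord_ne_zero k)
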